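/- A family of sets $K_1,\dots,K_k\subset\mathbb R^2$ covers $X\subset\mathbb R^2$ if $\bigcup_{i=1}^k K_i=X$. A finite set $P\subset\mathbb R^2$ is in general position if no three distinct points of $P$ are collinear. For such $P$, let $\mathrm{cov}(P)$ be the minimal number of convex sets that cover $\mathbb R^2\setminus P$, and for an integer $n\ge 0$ let $\mathrm{cov}(n)=\max \mathrm{cov}(P)$, the maximum being over all sets $P\subset\mathbb R^2$ of $n$ points in general position. Theorem. For every $n\ge 0$, the complement $\mathbb R^2\setminus P$ of any set $P$ of $n$ points in general position in the plane can be covered by at most $\frac{7n}{11}+4$ convex sets; that is, $$\mathrm{cov}(n)\le \frac{7n}{11}+4 .$$ -/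

import Mathlib

open scoped ENNReal

/-- The Euclidean plane. -/
abbrev Plane : Type := EuclideanSpace ℝ (Fin 2)

/-- A set of points is in general position if no three distinct points of it are collinear. -/
def InGeneralPosition (P : Set Plane) : Prop :=
  ∀ a ∈ P, ∀ b ∈ P, ∀ c ∈ P, a ≠ b → b ≠ c → a ≠ c → ¬ Collinear ℝ ({a, b, c} : Set Plane)

/-- `X` is covered by `k` convex sets: `X` is exactly the union of `k` convex sets. -/
def CoveredByConvex (k : ℕ) (X : Set Plane) : Prop :=
  ∃ K : Fin k → Set Plane, (∀ i, Convex ℝ (K i)) ∧ (⋃ i, K i) = X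

/-- The least number of convex sets that cover `X`; it is `⊤` if no finite number suffices. -/
noncomputable def convexityNumber (X : Set Plane) : ℕ∞ :=
  ⨅ (k : ℕ) (_ : CoveredByConvex k X), (k : ℕ∞)

/-- `cov(n)`: the largest convexity number of the complement of `n` points in general position. -/
noncomputable def covMax (n : ℕ) : ℕ∞ :=
  ⨆ (P : Finset Plane) (_ : P.card = n) (_ : InGeneralPosition (P : Set Plane)),
    convexityNumber (P : Set Plane)ᶜ

/-! ### Elementary operations on convex covers -/

/-! Induction on the number of points: from a set of at least 17 points, eight can be deleted at the
price of five convex sets, and 5/8 < 7/11. Smaller sets are handled by the cruder rate of three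
points for two sets (`exists_cover_two_thirds`).

All deletions have one shape. The complement is cut by lines into convex pieces, and the points of
each line are shared out among the adjacent pieces so that only points of P are left over. A piece
free of P costs one set. A piece containing only undeleted points inherits their cover, because
intersecting a cover with a convex set does not lengthen it.

Eight points can be deleted in two ways. In the first, a ray starts inside a hull edge, passes
through two points of P and has four further points on one side, not counting the endpoint of the
edge (`exists_remove_eight_of_coordinates`). In the second, eight consecutive hull vertices bound a
cap without other points (`exists_remove_eight_of_cap`).

One of the two is always available. Let a point move along a hull edge from a to b and watch the set
of the first five points in angular order. If this set changes, then at that moment the ray through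
the two exchanged points is of the first kind (`eightRemovable_of_swap`). If it never changes, a
point u with at most five points to the right of the ray from one hull vertex has the same property
at the next one (`IsHullEdge.card_rightOf_le`), hence all around the hull. An interior u would then
be surrounded by three such vertices, whose right sides hold all points but u: at most 15. So points
seen this early are hull vertices (`IsHullVertex.of_card_rightOf_le`), caps of consecutive hull
vertices contain nothing else (`CutsOff.next`), and the second way applies. -/

theorem CoveredByConvex.union {k l : ℕ} {X Y : Set Plane} (hX : CoveredByConvex k X)
    (hY : CoveredByConvex l Y) : CoveredByConvex (k + l) (X ∪ Y) := by
  obtain ⟨K, hK, rfl⟩ := hX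
  obtain ⟨M, hM, rfl⟩ := hY
  refine ⟨Fin.append K M, fun i => ?_, ?_⟩
  · refine Fin.addCases (fun i => ?_) (fun i => ?_) i
    · simpa using hK i
    · simpa using hM i
  · ext z
    simp only [Set.mem_iUnion, Set.mem_union]
    constructor
    · rintro ⟨i, hi⟩
      induction i using Fin.addCases with
      | left i => left; exact ⟨i, by simpa using hi⟩
      | right i => right; exact ⟨i, by simpa using hi⟩
    · rintro (⟨i, hi⟩ | ⟨i, hi⟩)
      · exact ⟨Fin.castAdd l i, by simpa using hi⟩
      · exact ⟨Fin.natAdd k i, by simpa using hi⟩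

theorem CoveredByConvex.inter {k : ℕ} {X C : Set Plane} (hX : CoveredByConvex k X)
    (hC : Convex ℝ C) : CoveredByConvex k (X ∩ C) := by
  obtain ⟨K, hK, rfl⟩ := hX
  exact ⟨fun i => K i ∩ C, fun i => (hK i).inter hC, by rw [Set.iUnion_inter]⟩

theorem Convex.coveredByConvex {C : Set Plane} (hC : Convex ℝ C) : CoveredByConvex 1 C :=
  ⟨fun _ => C, fun _ => hC, Set.iUnion_const C⟩

theorem coveredByConvex_empty (k : ℕ) : CoveredByConvex k (∅ : Set Plane) :=
  ⟨fun _ => ∅, fun _ => convex_empty, by simp⟩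

theorem CoveredByConvex.mono {k l : ℕ} {X : Set Plane} (hX : CoveredByConvex k X) (h : k ≤ l) :
    CoveredByConvex l X := by
  obtain ⟨j, rfl⟩ := Nat.exists_eq_add_of_le h
  simpa using hX.union (coveredByConvex_empty j)

/-- Inside a convex set, only the removed points that belong to it matter. -/
theorem CoveredByConvex.compl_inter {k : ℕ} {P Q : Finset Plane} {A : Set Plane}
    (hk : CoveredByConvex k (Q : Set Plane)ᶜ) (hA : Convex ℝ A) (hQP : Q ⊆ P)
    (h : ∀ z ∈ P, z ∈ A → z ∈ Q) : CoveredByConvex k ((P : Set Plane)ᶜ ∩ A) := by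
  have : (P : Set Plane)ᶜ ∩ A = (Q : Set Plane)ᶜ ∩ A := by
    ext z
    simp only [Set.mem_inter_iff, Set.mem_compl_iff, Finset.mem_coe]
    constructor
    · rintro ⟨h1, h2⟩
      exact ⟨fun h3 => h1 (hQP h3), h2⟩
    · rintro ⟨h1, h2⟩
      exact ⟨fun h3 => h1 (h z h3 h2), h2⟩
  rw [this]
  exact hk.inter hA

theorem Convex.coveredByConvex_compl_inter {P : Finset Plane} {A : Set Plane} (hA : Convex ℝ A)
    (h : ∀ z ∈ P, z ∉ A) : CoveredByConvex 1 ((P : Set Plane)ᶜ ∩ A) :=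
  CoveredByConvex.compl_inter (Q := ∅) (by simpa using convex_univ.coveredByConvex) hA (by simp)
    (fun z hz hzA => (h z hz hzA).elim)

/-! ### Affine functions on the plane -/

/-- `f` preserves affine combinations of two points. -/
def IsAff (f : Plane → ℝ) : Prop :=
  ∀ x y : Plane, ∀ s t : ℝ, s + t = 1 → f (s • x + t • y) = s * f x + t * f y

theorem IsAff.neg {f : Plane → ℝ} (hf : IsAff f) : IsAff (fun z => - f z) := by
  intro x y s t h
  simp only [hf x y s t h]; ring

theorem IsAff.comb {f g : Plane → ℝ} (hf : IsAff f) (hg : IsAff g) (α β γ : ℝ) :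
    IsAff (fun z => α * f z + β * g z + γ) := by
  intro x y s t h
  simp only [hf x y s t h, hg x y s t h]
  linear_combination (-γ) * h

theorem IsAff.convex_lt {f : Plane → ℝ} (hf : IsAff f) (c : ℝ) : Convex ℝ {z | f z < c} := by
  intro x hx y hy s t hs ht hst
  simp only [Set.mem_ofPred_eq] at *
  rw [hf x y s t hst]
  rcases hs.eq_or_lt with rfl | hs
  · have : t = 1 := by linarith
    subst this; linarith
  · have h1 := mul_lt_mul_of_pos_left hx hs
    have h2 := mul_le_mul_of_nonneg_left hy.le ht
    have : s * c + t * c = c := by rw [← add_mul, hst, one_mul]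
    linarith

theorem IsAff.convex_gt {f : Plane → ℝ} (hf : IsAff f) (c : ℝ) : Convex ℝ {z | c < f z} := by
  have := hf.neg.convex_lt (-c)
  simpa using this

/-- An open half-plane together with a convex part of its boundary line. -/
theorem IsAff.convex_pos_or {f : Plane → ℝ} (hf : IsAff f) {I : Set Plane} (hI : Convex ℝ I) :
    Convex ℝ {z | 0 < f z ∨ (f z = 0 ∧ z ∈ I)} := by
  intro x hx y hy s t hs ht hst
  simp only [Set.mem_ofPred_eq] at *
  rw [hf x y s t hst]
  rcases hs.eq_or_lt with rfl | hs'
  · have : t = 1 := by linarith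
    subst this; simpa using hy
  rcases ht.eq_or_lt with rfl | ht'
  · have : s = 1 := by linarith
    subst this; simpa using hx
  rcases hx with hx | ⟨hx, hxI⟩ <;> rcases hy with hy | ⟨hy, hyI⟩
  · left; positivity
  · left; rw [hy]; simp only [mul_zero, add_zero]; positivity
  · left; rw [hx]; simp only [mul_zero, zero_add]; positivity
  · right; exact ⟨by rw [hx, hy]; ring, hI hxI hyI hs ht hst⟩

theorem IsAff.convex_neg_or {f : Plane → ℝ} (hf : IsAff f) {I : Set Plane} (hI : Convex ℝ I) :
    Convex ℝ {z | f z < 0 ∨ (f z = 0 ∧ z ∈ I)} := by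
  have := hf.neg.convex_pos_or hI
  simpa using this

theorem isAff_coord (i : Fin 2) : IsAff (fun z => z i) := by
  intro x y s t _
  simp

theorem plane_ext {z w : Plane} (h0 : z 0 = w 0) (h1 : z 1 = w 1) : z = w := by
  ext i; fin_cases i <;> assumption

/-! ### Orientation -/

/-- Twice the signed area of the triangle `a b c`: positive if `c` is to the left of `a → b`. -/
def ori (a b c : Plane) : ℝ := (b 0 - a 0) * (c 1 - a 1) - (b 1 - a 1) * (c 0 - a 0)

theorem isAff_ori (a b : Plane) : IsAff (ori a b) := by
  intro x y s t h
  simp only [ori, PiLp.add_apply, PiLp.smul_apply, smul_eq_mul]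
  linear_combination (a 1 * (b 0 - a 0) - a 0 * (b 1 - a 1)) * h

theorem ori_rotate (a b c : Plane) : ori b c a = ori a b c := by simp only [ori]; ring

theorem ori_swap (a b c : Plane) : ori a c b = - ori a b c := by simp only [ori]; ring

theorem ori_swap' (a b c : Plane) : ori b a c = - ori a b c := by simp only [ori]; ring

theorem ori_self_right (a b : Plane) : ori a b b = 0 := by simp only [ori]; ring

theorem ori_self_left (a b : Plane) : ori a b a = 0 := by simp only [ori]; ring

/-- The scalar product of `b - a` and `z - a`. -/
def along (a b z : Plane) : ℝ := (b 0 - a 0) * (z 0 - a 0) + (b 1 - a 1) * (z 1 - a 1)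

theorem isAff_along (a b : Plane) : IsAff (along a b) := by
  intro x y s t h
  simp only [along, PiLp.add_apply, PiLp.smul_apply, smul_eq_mul]
  linear_combination (a 0 * (b 0 - a 0) + a 1 * (b 1 - a 1)) * h

theorem along_self_left (a b : Plane) : along a b a = 0 := by simp only [along]; ring

theorem sq_add_sq_pos_of_ne {a b : Plane} (h : a ≠ b) :
    0 < (b 0 - a 0) ^ 2 + (b 1 - a 1) ^ 2 := by
  by_contra hc
  have h0 : b 0 - a 0 = 0 := by
    nlinarith [sq_nonneg (b 0 - a 0), sq_nonneg (b 1 - a 1)]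
  have h1 : b 1 - a 1 = 0 := by
    nlinarith [sq_nonneg (b 0 - a 0), sq_nonneg (b 1 - a 1)]
  exact h (plane_ext (by linarith) (by linarith))

theorem along_self_right_pos {a b : Plane} (h : a ≠ b) : 0 < along a b b := by
  have := sq_add_sq_pos_of_ne h
  simp only [along]; nlinarith

theorem eq_of_ori_of_along {a b : Plane} (h : a ≠ b) {z w : Plane} (h1 : ori a b z = ori a b w)
    (h2 : along a b z = along a b w) : z = w := by
  have hp := sq_add_sq_pos_of_ne h
  simp only [ori, along] at h1 h2
  apply plane_ext
  · apply mul_left_cancel₀ hp.ne'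
    linear_combination (b 0 - a 0) * h2 - (b 1 - a 1) * h1
  · apply mul_left_cancel₀ hp.ne'
    linear_combination (b 1 - a 1) * h2 + (b 0 - a 0) * h1

theorem collinear_of_ori_eq_zero {a b c : Plane} (hab : a ≠ b) (h : ori a b c = 0) :
    Collinear ℝ ({a, b, c} : Set Plane) := by
  have hp := sq_add_sq_pos_of_ne hab
  rw [collinear_iff_of_mem (p₀ := a) (by simp)]
  refine ⟨b - a, ?_⟩
  simp only [Set.mem_insert_iff, Set.mem_singleton_iff, forall_eq_or_imp, forall_eq, vadd_eq_add]
  refine ⟨⟨0, by simp⟩, ⟨1, by simp⟩,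
    ⟨along a b c / ((b 0 - a 0) ^ 2 + (b 1 - a 1) ^ 2), ?_⟩⟩
  simp only [ori] at h
  apply plane_ext
  · simp only [PiLp.add_apply, PiLp.smul_apply, PiLp.sub_apply, smul_eq_mul, along]
    field_simp
    linear_combination (-(b 1 - a 1)) * h
  · simp only [PiLp.add_apply, PiLp.smul_apply, PiLp.sub_apply, smul_eq_mul, along]
    field_simp
    linear_combination (b 0 - a 0) * h

theorem InGeneralPosition.ori_ne_zero {P : Set Plane} (hP : InGeneralPosition P) {a b c : Plane}
    (ha : a ∈ P) (hb : b ∈ P) (hc : c ∈ P) (hab : a ≠ b) (hbc : b ≠ c) (hac : a ≠ c) :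
    ori a b c ≠ 0 :=
  fun h => hP a ha b hb c hc hab hbc hac (collinear_of_ori_eq_zero hab h)

theorem InGeneralPosition.subset {P Q : Set Plane} (hP : InGeneralPosition P) (h : Q ⊆ P) :
    InGeneralPosition Q :=
  fun a ha b hb c hc => hP a (h ha) b (h hb) c (h hc)

/-- Points on one side of a line through `b` are ordered angularly around `b` by a real key. -/
theorem exists_angular_key (b : Plane) (d0 d1 : ℝ) : ∃ key : Plane → ℝ, ∀ p q : Plane,
    0 < d0 * (p 1 - b 1) - d1 * (p 0 - b 0) → 0 < d0 * (q 1 - b 1) - d1 * (q 0 - b 0) →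
    (key q ≤ key p ↔ 0 ≤ ori b p q) := by
  -- The key is the cotangent of the angle from the direction d, so a larger key means a smaller
  -- angle.
  refine ⟨fun q => (d0 * (q 0 - b 0) + d1 * (q 1 - b 1)) / (d0 * (q 1 - b 1) - d1 * (q 0 - b 0)),
    fun p q hp hq => ?_⟩
  have hd : 0 < d0 ^ 2 + d1 ^ 2 := by
    by_contra hc
    have h0 : d0 = 0 := by nlinarith [sq_nonneg d0, sq_nonneg d1]
    have h1 : d1 = 0 := by nlinarith [sq_nonneg d0, sq_nonneg d1]
    simp [h0, h1] at hp
  rw [div_le_div_iff₀ hq hp, ← sub_nonneg]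
  rw [show (d0 * (p 0 - b 0) + d1 * (p 1 - b 1)) * (d0 * (q 1 - b 1) - d1 * (q 0 - b 0)) -
    (d0 * (q 0 - b 0) + d1 * (q 1 - b 1)) * (d0 * (p 1 - b 1) - d1 * (p 0 - b 0))
    = (d0 ^ 2 + d1 ^ 2) * ori b p q by simp only [ori]; ring]
  exact mul_nonneg_iff_of_pos_left hd

theorem exists_top_subset (key : Plane → ℝ) (k : ℕ) : ∀ S : Finset Plane, k ≤ S.card →
    ∃ T ⊆ S, T.card = k ∧ ∀ e ∈ T, ∀ f ∈ S, f ∉ T → key f ≤ key e := by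
  classical
  induction k with
  | zero => exact fun S _ => ⟨∅, by simp, by simp, by simp⟩
  | succ k ih =>
    intro S hS
    have hne : S.Nonempty := Finset.card_pos.mp (by omega)
    obtain ⟨c, hc, hmax⟩ := Finset.exists_max_image S key hne
    obtain ⟨T, hT, hTc, hTk⟩ := ih (S.erase c) (by rw [Finset.card_erase_of_mem hc]; omega)
    have hcT : c ∉ T := fun h => by simpa using hT h
    refine ⟨insert c T, ?_, by rw [Finset.card_insert_of_notMem hcT, hTc], ?_⟩
    · intro z hz
      rcases Finset.mem_insert.mp hz with rfl | hz
      · exact hc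
      · exact Finset.mem_of_mem_erase (hT hz)
    · intro e he f hf hfT
      simp only [Finset.mem_insert, not_or] at hfT
      rcases Finset.mem_insert.mp he with rfl | he
      · exact hmax f hf
      · exact hTk e he f (Finset.mem_erase.mpr ⟨hfT.1, hf⟩) hfT.2

/-! ### Edges of the convex hull -/

/-- `a → b` is a counterclockwise edge of the convex hull of `P`. -/
def IsHullEdge (P : Finset Plane) (a b : Plane) : Prop :=
  a ∈ P ∧ b ∈ P ∧ a ≠ b ∧ ∀ q ∈ P, q ≠ a → q ≠ b → 0 < ori a b q

/-- A point of `P` where a hull edge starts. -/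
def IsHullVertex (P : Finset Plane) (a : Plane) : Prop := ∃ b, IsHullEdge P a b

theorem exists_angular_first {P : Finset Plane} (hP : InGeneralPosition (P : Set Plane))
    {b : Plane} (hb : b ∈ P) {d0 d1 : ℝ} {S : Finset Plane} (hS : S ⊆ P) (hSb : b ∉ S)
    (hne : S.Nonempty) (hd : ∀ q ∈ S, 0 < d0 * (q 1 - b 1) - d1 * (q 0 - b 0)) :
    ∃ c ∈ S, ∀ q ∈ S, q ≠ c → 0 < ori b c q := by
  obtain ⟨key, hkey⟩ := exists_angular_key b d0 d1
  obtain ⟨c, hc, hmax⟩ := Finset.exists_max_image S key hne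
  refine ⟨c, hc, fun q hq hqc => ?_⟩
  have h1 := (hkey c q (hd c hc) (hd q hq)).mp (hmax q hq)
  refine lt_of_le_of_ne h1 (Ne.symm (hP.ori_ne_zero hb (hS hc) (hS hq) ?_ (Ne.symm hqc) ?_))
  · rintro rfl; exact hSb hc
  · rintro rfl; exact hSb hq

theorem exists_hullEdge {P : Finset Plane} (hP : InGeneralPosition (P : Set Plane))
    (hc : 2 ≤ P.card) : ∃ a b, IsHullEdge P a b := by
  classical
  obtain ⟨p, hp, hmin⟩ := Finset.exists_min_image P (fun z => z 0) (Finset.card_pos.mp (by omega))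
  by_cases h : ∃ q ∈ P, q ≠ p ∧ q 0 = p 0
  · obtain ⟨q, hq, hqp, h0⟩ := h
    have key : ∀ z ∈ P, z ≠ p → z ≠ q → p 0 < z 0 := by
      intro z hz hzp hzq
      refine lt_of_le_of_ne (hmin z hz) fun hpz => ?_
      refine hP.ori_ne_zero hp hq hz hqp.symm (Ne.symm hzq) (Ne.symm hzp) ?_
      simp only [ori, h0, ← hpz]; ring
    have h1 : q 1 ≠ p 1 := fun h1 => hqp (plane_ext h0 h1)
    rcases lt_or_gt_of_ne h1 with h1 | h1
    · refine ⟨p, q, hp, hq, hqp.symm, fun z hz hzp hzq => ?_⟩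
      have := key z hz hzp hzq
      simp only [ori, h0]; nlinarith
    · refine ⟨q, p, hq, hp, hqp, fun z hz hzq hzp => ?_⟩
      have := key z hz hzp hzq
      simp only [ori, h0]; nlinarith
  · push Not at h
    -- With a unique leftmost point p, sweep counterclockwise around p from the downward direction.
    obtain ⟨c, hc', hcq⟩ := exists_angular_first hP hp (d0 := 0) (d1 := -1)
      (S := P.erase p) (Finset.erase_subset _ _) (by simp)
      (Finset.card_pos.mp (by rw [Finset.card_erase_of_mem hp]; omega)) (by
        intro q hq
        have h1 := Finset.mem_erase.mp hq
        have h2 := lt_of_le_of_ne (hmin q h1.2) (Ne.symm (h q h1.2 h1.1))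
        linarith)
    have hcp := Finset.mem_erase.mp hc'
    exact ⟨p, c, hp, hcp.2, hcp.1.symm, fun q hq hqp hqc =>
      hcq q (Finset.mem_erase.mpr ⟨hqp, hq⟩) hqc⟩

/-- Gift wrapping: all other points lie to the left of a → b, so they have an angularly first one
around b. -/
theorem IsHullEdge.exists_next {P : Finset Plane} (hP : InGeneralPosition (P : Set Plane))
    (hc : 3 ≤ P.card) {a b : Plane} (h : IsHullEdge P a b) : ∃ c, IsHullEdge P b c := by
  classical
  obtain ⟨ha, hb, hab, hq⟩ := h
  obtain ⟨c, hc', hcq⟩ := exists_angular_first hP hb (d0 := b 0 - a 0) (d1 := b 1 - a 1)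
    (S := (P.erase a).erase b) ((Finset.erase_subset _ _).trans (Finset.erase_subset _ _)) (by simp)
    (Finset.card_pos.mp (by
      rw [Finset.card_erase_of_mem (Finset.mem_erase.mpr ⟨hab.symm, hb⟩),
        Finset.card_erase_of_mem ha]; omega)) (by
      intro q hqm
      simp only [Finset.mem_erase] at hqm
      have := hq q hqm.2.2 hqm.2.1 hqm.1
      simp only [ori] at this
      linarith)
  simp only [Finset.mem_erase] at hc' hcq
  refine ⟨c, hb, hc'.2.2, hc'.1.symm, fun q hqP hqb hqc => ?_⟩
  by_cases hqa : q = a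
  · subst hqa
    rw [ori_rotate]
    exact hq c hc'.2.2 hc'.2.1 hc'.1
  · exact hcq q ⟨hqb, hqa, hqP⟩ hqc

theorem IsHullEdge.ori_nonneg {P : Finset Plane} {a b q : Plane} (h : IsHullEdge P a b)
    (hq : q ∈ P) : 0 ≤ ori a b q := by
  by_cases hqa : q = a
  · rw [hqa, ori_self_left]
  by_cases hqb : q = b
  · rw [hqb, ori_self_right]
  exact (h.2.2.2 q hq hqa hqb).le

/-! ### Removing few points at the cost of few convex sets -/

theorem exists_remove_one {P : Finset Plane} (hne : P.Nonempty) :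
    ∃ Q ⊆ P, Q.card + 1 = P.card ∧
      ∀ k, CoveredByConvex k (Q : Set Plane)ᶜ → CoveredByConvex (k + 1) (P : Set Plane)ᶜ := by
  classical
  -- Lexicographic minimality also keeps P off the part of the vertical line below p, which joins
  -- the empty left half-plane.
  obtain ⟨p, hp, hmin⟩ := Finset.exists_min_image P (fun z => toLex (z 0, z 1)) hne
  refine ⟨P.erase p, Finset.erase_subset _ _, Finset.card_erase_add_one hp, fun k hk => ?_⟩
  have aff : IsAff (fun z => z 0 - p 0) := by
    have := (isAff_coord 0).comb (isAff_coord 0) 1 0 (-p 0)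
    simpa [sub_eq_add_neg] using this
  set A : Set Plane := {z | z 0 - p 0 < 0 ∨ (z 0 - p 0 = 0 ∧ z ∈ {z : Plane | z 1 < p 1})} with hA
  set B : Set Plane := {z | 0 < z 0 - p 0 ∨ (z 0 - p 0 = 0 ∧ z ∈ {z : Plane | p 1 < z 1})} with hB
  have cA : Convex ℝ A := aff.convex_neg_or ((isAff_coord 1).convex_lt _)
  have cB : Convex ℝ B := aff.convex_pos_or ((isAff_coord 1).convex_gt _)
  have h1 : CoveredByConvex 1 ((P : Set Plane)ᶜ ∩ A) := by
    refine cA.coveredByConvex_compl_inter fun z hz hzA => ?_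
    have := hmin z hz
    rw [Prod.Lex.toLex_le_toLex] at this
    simp only [hA, Set.mem_ofPred_eq] at hzA
    rcases this with h | h <;> rcases hzA with h' | h' <;> simp only at h
    · linarith
    · linarith [h'.1]
    · linarith [h.1]
    · linarith [h.2, h'.2]
  have h2 : CoveredByConvex k ((P : Set Plane)ᶜ ∩ B) := by
    refine hk.compl_inter cB (Finset.erase_subset _ _) fun z hz hzB => ?_
    refine Finset.mem_erase.mpr ⟨?_, hz⟩
    rintro rfl
    simp [hB] at hzB
  convert h2.union h1 using 1
  ext z
  simp only [Set.mem_union, Set.mem_inter_iff]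
  refine ⟨fun hz => ?_, fun hz => hz.elim And.left And.left⟩
  simp only [hA, hB, Set.mem_ofPred_eq]
  rcases lt_trichotomy (z 0 - p 0) 0 with h | h | h
  · exact Or.inr ⟨hz, Or.inl h⟩
  · rcases lt_trichotomy (z 1) (p 1) with h' | h' | h'
    · exact Or.inr ⟨hz, Or.inr ⟨h, h'⟩⟩
    · exact (hz (by rw [plane_ext (sub_eq_zero.mp h) h']; exact hp)).elim
    · exact Or.inl ⟨hz, Or.inr ⟨h, h'⟩⟩
  · exact Or.inl ⟨hz, Or.inl h⟩

/-- A line supporting `P` in two points `a`, `b`, and a ray that starts between them and passes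
through the angularly extreme remaining point, remove three points. -/
theorem exists_remove_three_of_coordinates {P : Finset Plane} {h τ : Plane → ℝ} (hh : IsAff h)
    (hτ : IsAff τ) (inj : ∀ z w, h z = h w → τ z = τ w → z = w) {a b : Plane} (ha : a ∈ P)
    (hb : b ∈ P) (ha0 : h a = 0) (hb0 : h b = 0) (hτa : τ a < 0) (hτb : 0 < τ b)
    (hpos : ∀ q ∈ P, q ≠ a → q ≠ b → 0 < h q) (hc : 3 ≤ P.card) :
    ∃ Q ⊆ P, Q.card + 3 = P.card ∧
      ∀ k, CoveredByConvex k (Q : Set Plane)ᶜ → CoveredByConvex (k + 2) (P : Set Plane)ᶜ := by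
  classical
  have hab : a ≠ b := by rintro rfl; linarith
  have hb' : b ∈ P.erase a := Finset.mem_erase.mpr ⟨hab.symm, hb⟩
  have hcS : ((P.erase a).erase b).card + 2 = P.card := by
    rw [Finset.card_erase_of_mem hb', Finset.card_erase_of_mem ha]; omega
  -- The ratio orders directions from the origin `h = τ = 0`. Two points may share a direction; the
  -- farther one is taken, so that the ray beyond g is free of P.
  obtain ⟨g, hg, hmax⟩ := Finset.exists_max_image ((P.erase a).erase b)
    (fun z => toLex (τ z / h z, h z)) (Finset.card_pos.mp (by omega))
  have hgP := hg
  simp only [Finset.mem_erase] at hgP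
  have hg0 : 0 < h g := hpos g hgP.2.2 hgP.2.1 hgP.1
  refine ⟨((P.erase a).erase b).erase g, ?_, ?_, fun k hk => ?_⟩
  · exact (Finset.erase_subset _ _).trans ((Finset.erase_subset _ _).trans (Finset.erase_subset _ _))
  · rw [Finset.card_erase_of_mem hg]; omega
  have hr : IsAff (fun z => τ g * h z + (-h g) * τ z + 0) := hh.comb hτ _ _ _
  set r : Plane → ℝ := fun z => τ g * h z + (-h g) * τ z + 0 with hrdef
  have rg : r g = 0 := by simp only [hrdef]; ring
  have ra : 0 < r a := by simp only [hrdef, ha0]; nlinarith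
  have rb : r b < 0 := by simp only [hrdef, hb0]; nlinarith
  -- H takes the open segment ab. L takes the ray beyond g and the supporting line beyond b. R takes
  -- the ray before g and the supporting line beyond a.
  set H : Set Plane := {z | h z < 0 ∨ (h z = 0 ∧ z ∈ {z | τ a < τ z} ∩ {z | τ z < τ b})} with hH
  set L : Set Plane := {z | r z < 0 ∨ (r z = 0 ∧ z ∈ {z | h g < h z})} ∩
    {z | 0 < h z ∨ (h z = 0 ∧ z ∈ {z | τ b < τ z})} with hL
  set R : Set Plane := {z | 0 < r z ∨ (r z = 0 ∧ z ∈ {z | h z < h g})} ∩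
    {z | 0 < h z ∨ (h z = 0 ∧ z ∈ {z | τ z < τ a})} with hR
  have cH : Convex ℝ H := hh.convex_neg_or ((hτ.convex_gt _).inter (hτ.convex_lt _))
  have cL : Convex ℝ L :=
    (hr.convex_neg_or (hh.convex_gt _)).inter (hh.convex_pos_or (hτ.convex_gt _))
  have cR : Convex ℝ R :=
    (hr.convex_pos_or (hh.convex_lt _)).inter (hh.convex_pos_or (hτ.convex_lt _))
  have h1 : CoveredByConvex 1 ((P : Set Plane)ᶜ ∩ H) := by
    refine cH.coveredByConvex_compl_inter fun z hz hzH => ?_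
    simp only [hH, Set.mem_ofPred_eq, Set.mem_inter_iff] at hzH
    by_cases hza : z = a
    · subst hza; rcases hzH with h' | ⟨h', h1, h2⟩ <;> linarith
    by_cases hzb : z = b
    · subst hzb; rcases hzH with h' | ⟨h', h1, h2⟩ <;> linarith
    have := hpos z hz hza hzb
    rcases hzH with h | h
    · linarith
    · linarith [h.1]
  have h2 : CoveredByConvex 1 ((P : Set Plane)ᶜ ∩ L) := by
    refine cL.coveredByConvex_compl_inter fun z hz hzL => ?_
    simp only [hL, Set.mem_ofPred_eq, Set.mem_inter_iff] at hzL
    by_cases hza : z = a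
    · subst hza; rcases hzL.1 with h' | ⟨h', h''⟩ <;> linarith
    by_cases hzb : z = b
    · subst hzb; rcases hzL.2 with h' | ⟨h', h''⟩ <;> linarith
    have hz0 := hpos z hz hza hzb
    have hm := hmax z (by simp only [Finset.mem_erase]; exact ⟨hzb, hza, hz⟩)
    rw [Prod.Lex.toLex_le_toLex] at hm
    rcases hm with hm | ⟨hm, hm'⟩
    · simp only [div_lt_div_iff₀ hz0 hg0] at hm
      rcases hzL.1 with h | h
      · simp only [hrdef] at h; nlinarith
      · have := h.1; simp only [hrdef] at this; nlinarith
    · simp only [div_eq_div_iff hz0.ne' hg0.ne'] at hm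
      have rz : r z = 0 := by simp only [hrdef]; linarith
      rcases hzL.1 with h | h
      · linarith
      · exact absurd h.2 (not_lt.mpr hm')
  have h3 : CoveredByConvex k ((P : Set Plane)ᶜ ∩ R) := by
    refine hk.compl_inter cR ((Finset.erase_subset _ _).trans
      ((Finset.erase_subset _ _).trans (Finset.erase_subset _ _))) fun z hz hzR => ?_
    simp only [hR, Set.mem_ofPred_eq, Set.mem_inter_iff] at hzR
    simp only [Finset.mem_erase]
    refine ⟨?_, ?_, ?_, hz⟩
    · rintro rfl; rcases hzR.1 with h' | ⟨h', h''⟩ <;> linarith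
    · rintro rfl; rcases hzR.1 with h' | ⟨h', h''⟩ <;> linarith
    · rintro rfl; rcases hzR.2 with h' | ⟨h', h''⟩ <;> linarith
  convert h3.union (h2.union h1) using 1
  ext z
  simp only [Set.mem_union, Set.mem_inter_iff, ← and_or_left]
  refine ⟨fun hz => ⟨hz, ?_⟩, And.left⟩
  simp only [hH, hL, hR, Set.mem_ofPred_eq, Set.mem_inter_iff]
  rcases lt_trichotomy (h z) 0 with h0 | h0 | h0
  · exact Or.inr (Or.inr (Or.inl h0))
  · have rz : r z = - (h g * τ z) := by simp only [hrdef, h0]; ring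
    rcases lt_trichotomy (τ z) (τ a) with h1 | h1 | h1
    · exact Or.inl ⟨Or.inl (by rw [rz]; nlinarith), Or.inr ⟨h0, h1⟩⟩
    · exact (hz (by rw [inj z a (by rw [h0, ha0]) h1]; exact ha)).elim
    rcases lt_trichotomy (τ z) (τ b) with h2 | h2 | h2
    · exact Or.inr (Or.inr (Or.inr ⟨h0, h1, h2⟩))
    · exact (hz (by rw [inj z b (by rw [h0, hb0]) h2]; exact hb)).elim
    · exact Or.inr (Or.inl ⟨Or.inl (by rw [rz]; nlinarith), Or.inr ⟨h0, h2⟩⟩)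
  · rcases lt_trichotomy (r z) 0 with h1 | h1 | h1
    · exact Or.inr (Or.inl ⟨Or.inl h1, Or.inl h0⟩)
    · rcases lt_trichotomy (h z) (h g) with h2 | h2 | h2
      · exact Or.inl ⟨Or.inr ⟨h1, h2⟩, Or.inl h0⟩
      · refine (hz ?_).elim
        rw [inj z g h2 ?_]
        · exact hgP.2.2
        · have h3 : r z = r g := by rw [h1, rg]
          simp only [hrdef, h2] at h3
          exact mul_left_cancel₀ hg0.ne' (by linarith)
      · exact Or.inr (Or.inl ⟨Or.inr ⟨h1, h2⟩, Or.inl h0⟩)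
    · exact Or.inl ⟨Or.inl h1, Or.inl h0⟩

theorem exists_remove_three {P : Finset Plane} (hP : InGeneralPosition (P : Set Plane))
    (hc : 3 ≤ P.card) : ∃ Q ⊆ P, Q.card + 3 = P.card ∧
      ∀ k, CoveredByConvex k (Q : Set Plane)ᶜ → CoveredByConvex (k + 2) (P : Set Plane)ᶜ := by
  obtain ⟨a, b, ha, hb, hab, hq⟩ := exists_hullEdge hP (by omega)
  have hpos := along_self_right_pos hab
  -- The second coordinate is shifted to vanish at the midpoint, hence has opposite signs at a and
  -- b.
  refine exists_remove_three_of_coordinates (isAff_ori a b)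
    ((isAff_along a b).comb (isAff_along a b) 1 0 (-(along a b b / 2)))
    (fun z w h1 h2 => eq_of_ori_of_along hab h1 (by linarith)) ha hb (ori_self_left a b)
    (ori_self_right a b) ?_ ?_ hq hc
  · simp only [along_self_left]; linarith
  · linarith

/-- The constant 5 is tight for this recursion at two points, which cost three sets when removed
singly. -/
theorem exists_cover_two_thirds (n : ℕ) : ∀ P : Finset Plane, P.card = n →
    InGeneralPosition (P : Set Plane) →
    ∃ k, 3 * k ≤ 2 * n + 5 ∧ CoveredByConvex k (P : Set Plane)ᶜ := by
  induction n using Nat.strong_induction_on with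
  | _ n ih =>
    intro P hPn hP
    by_cases h3 : 3 ≤ n
    · obtain ⟨Q, hQ, hc, hk⟩ := exists_remove_three hP (by omega)
      obtain ⟨k, hk1, hk2⟩ := ih (n - 3) (by omega) Q (by omega) (hP.subset (by exact_mod_cast hQ))
      exact ⟨k + 2, by omega, hk k hk2⟩
    rcases Nat.eq_zero_or_pos n with rfl | h0
    · rw [Finset.card_eq_zero] at hPn
      subst hPn
      exact ⟨1, by omega, by simpa using convex_univ.coveredByConvex⟩
    · obtain ⟨Q, hQ, hc, hk⟩ := exists_remove_one (Finset.card_pos.mp (by omega : 0 < P.card))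
      obtain ⟨k, hk1, hk2⟩ := ih (n - 1) (by omega) Q (by omega) (hP.subset (by exact_mod_cast hQ))
      exact ⟨k + 1, by omega, hk k hk2⟩

/-- A supporting line through `a`, `b` and a ray that starts between `a` and `b`, passes through
two points `p`, `q`, and has exactly four points on one side, remove eight points. -/
theorem exists_remove_eight_of_coordinates {P W : Finset Plane}
    (hP : InGeneralPosition (P : Set Plane)) {h r : Plane → ℝ}
    (hh : IsAff h) (hr : IsAff r) (inj : ∀ z w, h z = h w → r z = r w → z = w) {a b p q : Plane}
    (ha : a ∈ P) (hb : b ∈ P) (hp : p ∈ P) (hq : q ∈ P) (ha0 : h a = 0) (hb0 : h b = 0)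
    (hra : 0 < r a) (hrb : r b < 0) (hrp : r p = 0) (hrq : r q = 0) (hhp : 0 < h p)
    (hpq : h p < h q) (hpos : ∀ z ∈ P, z ≠ a → z ≠ b → 0 < h z) (hWP : W ⊆ P)
    (hW : W.card = 4) (hWr : ∀ w ∈ W, w ≠ b ∧ r w < 0)
    (hPr : ∀ z ∈ P, z ∉ W → z ≠ b → z ≠ p → z ≠ q → 0 < r z) :
    ∃ Q ⊆ P, Q.card + 8 = P.card ∧
      ∀ k, CoveredByConvex k (Q : Set Plane)ᶜ → CoveredByConvex (k + 5) (P : Set Plane)ᶜ := by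
  classical
  have hWh : ∀ w ∈ W, 0 < h w := fun w hw => hpos w (hWP hw)
    (by rintro rfl; linarith [(hWr w hw).2]) (hWr w hw).1
  -- The side of b is cut a second time, by a ray from the point x at height `hx` between p and q on
  -- the first ray. It passes through the point w of W of lowest direction from x, the nearest one
  -- in case of a tie.
  obtain ⟨hx, hpx, hxq⟩ := exists_between hpq
  obtain ⟨w, hw, hmin⟩ := Finset.exists_min_image W
    (fun z => toLex ((h z - hx) / (- r z), - r z)) (Finset.card_pos.mp (by omega))
  have hwr := (hWr w hw).2
  have hs : IsAff (fun z => (-r w) * h z + (h w - hx) * r z + r w * hx) := hh.comb hr _ _ _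
  set s : Plane → ℝ := fun z => (-r w) * h z + (h w - hx) * r z + r w * hx with hsdef
  -- For three points the bound reads 3k ≤ 11, so three sets suffice above the second ray.
  obtain ⟨k₃, hk₃, hcov₃⟩ := exists_cover_two_thirds 3 (W.erase w)
    (by rw [Finset.card_erase_of_mem hw, hW])
    (hP.subset (by exact_mod_cast (Finset.erase_subset _ _).trans hWP))
  have hcov3 : CoveredByConvex 3 ((W.erase w : Finset Plane) : Set Plane)ᶜ := hcov₃.mono (by omega)
  have hsub : ({a, b, p, q} ∪ W : Finset Plane) ⊆ P := by
    intro z hz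
    simp only [Finset.mem_union, Finset.mem_insert, Finset.mem_singleton] at hz
    rcases hz with (rfl | rfl | rfl | rfl) | hz
    · exact ha
    · exact hb
    · exact hp
    · exact hq
    · exact hWP hz
  have hcard : ({a, b, p, q} ∪ W : Finset Plane).card = 8 := by
    rw [Finset.card_union_of_disjoint, hW]
    · have : ({a, b, p, q} : Finset Plane).card = 4 := by
        rw [Finset.card_insert_of_notMem, Finset.card_insert_of_notMem,
          Finset.card_insert_of_notMem, Finset.card_singleton]
        · simp only [Finset.mem_singleton]; rintro rfl; linarith
        · simp only [Finset.mem_insert, Finset.mem_singleton]; rintro (rfl | rfl) <;> linarith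
        · simp only [Finset.mem_insert, Finset.mem_singleton]
          rintro (rfl | rfl | rfl) <;> linarith
      rw [this]
    · rw [Finset.disjoint_left]
      intro z hz hzW
      have h1 := hWr z hzW
      simp only [Finset.mem_insert, Finset.mem_singleton] at hz
      rcases hz with rfl | rfl | rfl | rfl
      · linarith
      · exact h1.1 rfl
      · linarith
      · linarith
  refine ⟨P \ ({a, b, p, q} ∪ W), Finset.sdiff_subset, ?_, fun k hk => ?_⟩
  · have := Finset.card_sdiff_add_card_eq_card hsub
    omega
  -- The five new sets are H outside the edge, A below the second ray (no point of P), and three for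
  -- B above it. On the first ray, A takes the part before p, R the part between p and q, and B the
  -- part beyond q. On the second ray, A takes the part up to w and B the rest.
  set H : Set Plane := {z | h z < 0 ∨ (h z = 0 ∧ z ∈ {z | r b < r z} ∩ {z | r z < r a})} with hH
  set A : Set Plane := {z | r z < 0 ∨ (r z = 0 ∧ z ∈ {z | h z < h p})} ∩
    {z | s z < 0 ∨ (s z = 0 ∧ z ∈ {z | r w < r z})} ∩
    {z | 0 < h z ∨ (h z = 0 ∧ z ∈ {z | r z < r b})} with hA
  set B : Set Plane := {z | r z < 0 ∨ (r z = 0 ∧ z ∈ {z | h q < h z})} ∩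
    {z | 0 < s z ∨ (s z = 0 ∧ z ∈ {z | r z < r w})} ∩
    {z | 0 < h z ∨ (h z = 0 ∧ z ∈ {z | r z < r b})} with hB
  set R : Set Plane := {z | 0 < r z ∨ (r z = 0 ∧ z ∈ {z | h p < h z} ∩ {z | h z < h q})} ∩
    {z | 0 < h z ∨ (h z = 0 ∧ z ∈ {z | r a < r z})} with hR
  have cH : Convex ℝ H := hh.convex_neg_or ((hr.convex_gt _).inter (hr.convex_lt _))
  have cA : Convex ℝ A := ((hr.convex_neg_or (hh.convex_lt _)).inter
    (hs.convex_neg_or (hr.convex_gt _))).inter (hh.convex_pos_or (hr.convex_lt _))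
  have cB : Convex ℝ B := ((hr.convex_neg_or (hh.convex_gt _)).inter
    (hs.convex_pos_or (hr.convex_lt _))).inter (hh.convex_pos_or (hr.convex_lt _))
  have cR : Convex ℝ R := (hr.convex_pos_or ((hh.convex_gt _).inter (hh.convex_lt _))).inter
    (hh.convex_pos_or (hr.convex_gt _))
  have h1 : CoveredByConvex 1 ((P : Set Plane)ᶜ ∩ H) := by
    refine cH.coveredByConvex_compl_inter fun z hz hzH => ?_
    simp only [hH, Set.mem_ofPred_eq, Set.mem_inter_iff] at hzH
    by_cases hza : z = a
    · subst hza; rcases hzH with h' | ⟨h', h1, h2⟩ <;> linarith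
    by_cases hzb : z = b
    · subst hzb; rcases hzH with h' | ⟨h', h1, h2⟩ <;> linarith
    have := hpos z hz hza hzb
    rcases hzH with h' | ⟨h', h1, h2⟩ <;> linarith
  have hside : ∀ z ∈ P, z ∉ W → (r z < 0 ∨ r z = 0) →
      (0 < h z ∨ (h z = 0 ∧ r z < r b)) → z = p ∨ z = q := by
    intro z hz hzW h1 h2
    by_contra hc
    push Not at hc
    by_cases hzb : z = b
    · subst hzb; rcases h2 with h' | ⟨h', h''⟩ <;> linarith
    have := hPr z hz hzW hzb hc.1 hc.2
    rcases h1 with h' | h' <;> linarith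
  have h2 : CoveredByConvex 1 ((P : Set Plane)ᶜ ∩ A) := by
    refine cA.coveredByConvex_compl_inter fun z hz hzA => ?_
    simp only [hA, Set.mem_ofPred_eq, Set.mem_inter_iff] at hzA
    obtain ⟨⟨hz1, hz2⟩, hz3⟩ := hzA
    by_cases hzW : z ∈ W
    · have hzr := (hWr z hzW).2
      have hm := hmin z hzW
      have e : s z = (h z - hx) * (-r w) - (h w - hx) * (-r z) := by simp only [hsdef]; ring
      rw [Prod.Lex.toLex_le_toLex] at hm
      rcases hm with hm | ⟨hm, hm'⟩
      · simp only [div_lt_div_iff₀ (neg_pos.mpr hwr) (neg_pos.mpr hzr)] at hm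
        rcases hz2 with h' | ⟨h', h''⟩ <;> linarith
      · simp only [div_eq_div_iff (neg_pos.mpr hwr).ne' (neg_pos.mpr hzr).ne'] at hm
        simp only at hm'
        rcases hz2 with h' | ⟨h', h''⟩ <;> linarith
    · rcases hside z hz hzW (hz1.imp id And.left) hz3 with rfl | rfl <;>
      rcases hz1 with h' | ⟨h', h''⟩ <;> linarith
  have h3 : CoveredByConvex 3 ((P : Set Plane)ᶜ ∩ B) := by
    refine hcov3.compl_inter cB ((Finset.erase_subset _ _).trans hWP) fun z hz hzB => ?_
    simp only [hB, Set.mem_ofPred_eq, Set.mem_inter_iff] at hzB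
    obtain ⟨⟨hz1, hz2⟩, hz3⟩ := hzB
    by_cases hzW : z ∈ W
    · refine Finset.mem_erase.mpr ⟨?_, hzW⟩
      rintro rfl
      have e : s z = 0 := by simp only [hsdef]; ring
      rcases hz2 with h' | ⟨h', h''⟩ <;> linarith
    · rcases hside z hz hzW (hz1.imp id And.left) hz3 with rfl | rfl <;>
      rcases hz1 with h' | ⟨h', h''⟩ <;> linarith
  have h4 : CoveredByConvex k ((P : Set Plane)ᶜ ∩ R) := by
    refine hk.compl_inter cR Finset.sdiff_subset fun z hz hzR => ?_
    simp only [hR, Set.mem_ofPred_eq, Set.mem_inter_iff] at hzR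
    obtain ⟨hz1, hz2⟩ := hzR
    simp only [Finset.mem_sdiff, Finset.mem_union, Finset.mem_insert, Finset.mem_singleton]
    refine ⟨hz, ?_⟩
    rintro ((rfl | rfl | rfl | rfl) | hzW)
    · rcases hz2 with h' | ⟨h', h''⟩ <;> linarith
    · rcases hz1 with h' | ⟨h', h''⟩ <;> linarith
    · rcases hz1 with h' | ⟨h', h1, h2⟩ <;> linarith
    · rcases hz1 with h' | ⟨h', h1, h2⟩ <;> linarith
    · have := (hWr z hzW).2
      rcases hz1 with h' | ⟨h', h1, h2⟩ <;> linarith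
  convert h4.union (h3.union (h2.union h1)) using 1
  ext z
  simp only [Set.mem_union, Set.mem_inter_iff, ← and_or_left]
  refine ⟨fun hz => ⟨hz, ?_⟩, And.left⟩
  have hz' : ∀ v ∈ P, h z = h v → r z ≠ r v := fun v hv e1 e2 => hz (by
    rw [inj z v e1 e2]; exact hv)
  have hright : r z < 0 → (0 < h z ∨ (h z = 0 ∧ r z < r b)) → z ∈ B ∨ z ∈ A := by
    intro hz1 hz2
    simp only [hA, hB, Set.mem_ofPred_eq, Set.mem_inter_iff]
    rcases lt_trichotomy (s z) 0 with h1 | h1 | h1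
    · exact Or.inr ⟨⟨Or.inl hz1, Or.inl h1⟩, hz2⟩
    · rcases lt_trichotomy (r z) (r w) with h2 | h2 | h2
      · exact Or.inl ⟨⟨Or.inl hz1, Or.inr ⟨h1, h2⟩⟩, hz2⟩
      · refine (hz' w (hWP hw) ?_ h2).elim
        simp only [hsdef, h2] at h1
        exact mul_left_cancel₀ (neg_pos.mpr hwr).ne' (by linarith)
      · exact Or.inr ⟨⟨Or.inl hz1, Or.inr ⟨h1, h2⟩⟩, hz2⟩
    · exact Or.inl ⟨⟨Or.inl hz1, Or.inl h1⟩, hz2⟩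
  rcases lt_trichotomy (h z) 0 with h0 | h0 | h0
  · exact Or.inr (Or.inr (Or.inr (Or.inl h0)))
  · rcases lt_trichotomy (r z) (r b) with h1 | h1 | h1
    · rcases hright (by linarith) (Or.inr ⟨h0, h1⟩) with h2 | h2
      · exact Or.inr (Or.inl h2)
      · exact Or.inr (Or.inr (Or.inl h2))
    · exact (hz' b hb (by rw [h0, hb0]) h1).elim
    rcases lt_trichotomy (r z) (r a) with h2 | h2 | h2
    · exact Or.inr (Or.inr (Or.inr (Or.inr ⟨h0, h1, h2⟩)))
    · exact (hz' a ha (by rw [h0, ha0]) h2).elim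
    · exact Or.inl ⟨Or.inl (by linarith), Or.inr ⟨h0, h2⟩⟩
  · rcases lt_trichotomy (r z) 0 with h1 | h1 | h1
    · rcases hright h1 (Or.inl h0) with h2 | h2
      · exact Or.inr (Or.inl h2)
      · exact Or.inr (Or.inr (Or.inl h2))
    · have e : s z = (-r w) * (h z - hx) := by simp only [hsdef, h1]; ring
      rcases lt_trichotomy (h z) (h p) with h2 | h2 | h2
      · exact Or.inr (Or.inr (Or.inl ⟨⟨Or.inr ⟨h1, h2⟩, Or.inl (by rw [e]; nlinarith)⟩,
          Or.inl h0⟩))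
      · exact (hz' p hp h2 (by rw [h1, hrp])).elim
      rcases lt_trichotomy (h z) (h q) with h3 | h3 | h3
      · exact Or.inl ⟨Or.inr ⟨h1, h2, h3⟩, Or.inl h0⟩
      · exact (hz' q hq h3 (by rw [h1, hrq])).elim
      · exact Or.inr (Or.inl ⟨⟨Or.inr ⟨h1, h3⟩, Or.inl (by rw [e]; nlinarith)⟩,
          Or.inl h0⟩)
    · exact Or.inl ⟨Or.inl h1, Or.inl h0⟩

/-! ### Cutting off a cap of eight consecutive hull vertices -/

/-- The part of the plane that projects to the line `a b` before `a`. -/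
def beforeSlab (a b : Plane) : Set Plane := {z | along a b z < 0}

/-- The part of the plane that projects to the line `a b` between `a` and `b`. -/
def midSlab (a b : Plane) : Set Plane := {z | 0 < along a b z} ∩ {z | along a b z < along a b b}

/-- The part of the plane that projects to the line `a b` after `b`. -/
def afterSlab (a b : Plane) : Set Plane := {z | along a b b < along a b z}

theorem convex_beforeSlab (a b : Plane) : Convex ℝ (beforeSlab a b) := (isAff_along a b).convex_lt _

theorem convex_midSlab (a b : Plane) : Convex ℝ (midSlab a b) :=
  ((isAff_along a b).convex_gt _).inter ((isAff_along a b).convex_lt _)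

theorem convex_afterSlab (a b : Plane) : Convex ℝ (afterSlab a b) := (isAff_along a b).convex_gt _

/-- The open right side of `a → b` with the part of the boundary line in `I`. -/
def rightSide (a b : Plane) (I : Set Plane) : Set Plane :=
  {z | ori a b z < 0 ∨ (ori a b z = 0 ∧ z ∈ I)}

/-- The open left side of `a → b` with the part of the boundary line in `I`. -/
def leftSide (a b : Plane) (I : Set Plane) : Set Plane :=
  {z | 0 < ori a b z ∨ (ori a b z = 0 ∧ z ∈ I)}

theorem convex_rightSide (a b : Plane) {I : Set Plane} (hI : Convex ℝ I) :
    Convex ℝ (rightSide a b I) := (isAff_ori a b).convex_neg_or hI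

theorem convex_leftSide (a b : Plane) {I : Set Plane} (hI : Convex ℝ I) :
    Convex ℝ (leftSide a b I) := (isAff_ori a b).convex_pos_or hI

theorem left_notMem_beforeSlab (a b : Plane) : a ∉ beforeSlab a b := by
  simp [beforeSlab, along_self_left]

theorem right_notMem_beforeSlab {a b : Plane} (h : a ≠ b) : b ∉ beforeSlab a b := by
  simpa [beforeSlab] using (along_self_right_pos h).le

theorem left_notMem_midSlab (a b : Plane) : a ∉ midSlab a b := by
  simp [midSlab, along_self_left]

theorem right_notMem_midSlab (a b : Plane) : b ∉ midSlab a b := by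
  simp [midSlab]

theorem left_notMem_afterSlab {a b : Plane} (h : a ≠ b) : a ∉ afterSlab a b := by
  simpa [afterSlab, along_self_left] using (along_self_right_pos h).le

theorem right_notMem_afterSlab (a b : Plane) : b ∉ afterSlab a b := by
  simp [afterSlab]

theorem mem_slab_cases {a b z : Plane} (hab : a ≠ b) (h : ori a b z = 0) (ha : z ≠ a)
    (hb : z ≠ b) : z ∈ beforeSlab a b ∨ z ∈ midSlab a b ∨ z ∈ afterSlab a b := by
  rcases lt_trichotomy (along a b z) 0 with h1 | h1 | h1
  · exact Or.inl h1
  · exact (ha (eq_of_ori_of_along hab (by rw [h, ori_self_left])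
      (by rw [h1, along_self_left]))).elim
  rcases lt_trichotomy (along a b z) (along a b b) with h2 | h2 | h2
  · exact Or.inr (Or.inl ⟨h1, h2⟩)
  · exact (hb (eq_of_ori_of_along hab (by rw [h, ori_self_right]) h2)).elim
  · exact Or.inr (Or.inr h2)

theorem eq_combo_of_ori_eq_zero {a b z : Plane} (hab : a ≠ b) (h : ori a b z = 0) :
    z = (1 - along a b z / along a b b) • a + (along a b z / along a b b) • b := by
  have hp := along_self_right_pos hab
  apply eq_of_ori_of_along hab
  · rw [isAff_ori a b _ _ _ _ (by ring), h, ori_self_left, ori_self_right]; ring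
  · rw [isAff_along a b _ _ _ _ (by ring), along_self_left]; field_simp; ring

theorem IsHullEdge.notMem_rightSide {P : Finset Plane} {a b : Plane} (h : IsHullEdge P a b)
    {I : Set Plane} (ha : a ∉ I) (hb : b ∉ I) : ∀ z ∈ P, z ∉ rightSide a b I := by
  intro z hz hzI
  rcases hzI with h1 | ⟨h1, h2⟩
  · exact absurd (h.ori_nonneg hz) (not_le.mpr h1)
  · by_cases hza : z = a
    · exact ha (hza ▸ h2)
    by_cases hzb : z = b
    · exact hb (hzb ▸ h2)
    exact absurd h1 (h.2.2.2 z hz hza hzb).ne'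

theorem left_notMem_leftSide {a b : Plane} {I : Set Plane} (ha : a ∉ I) : a ∉ leftSide a b I := by
  rintro (h | ⟨_, h⟩)
  · rw [ori_self_left] at h; exact lt_irrefl _ h
  · exact ha h

theorem right_notMem_leftSide {a b : Plane} {I : Set Plane} (hb : b ∉ I) : b ∉ leftSide a b I := by
  rintro (h | ⟨_, h⟩)
  · rw [ori_self_right] at h; exact lt_irrefl _ h
  · exact hb h

/-- The relative interior of a hull edge lies strictly to the left of every disjoint edge. -/
theorem IsHullEdge.ori_pos_of_midSlab {P : Finset Plane} {a b c d z : Plane}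
    (h : IsHullEdge P c d) (ha : a ∈ P) (hb : b ∈ P) (hab : a ≠ b) (hac : a ≠ c) (had : a ≠ d)
    (hbc : b ≠ c) (hbd : b ≠ d) (h0 : ori a b z = 0) (hz : z ∈ midSlab a b) : 0 < ori c d z := by
  have hp := along_self_right_pos hab
  have h1 : 0 < along a b z / along a b b := div_pos hz.1 hp
  have h2 : along a b z / along a b b < 1 := (div_lt_one hp).mpr hz.2
  rw [eq_combo_of_ori_eq_zero hab h0, isAff_ori c d _ _ _ _ (by ring)]
  have h3 := h.2.2.2 a ha hac had
  have h4 := h.2.2.2 b hb hbc hbd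
  have h5 := mul_pos (sub_pos.mpr h2) h3
  have h6 := mul_pos h1 h4
  linarith

/-- Beyond b the coefficient of a in the affine combination of a and b is negative. -/
theorem ori_neg_of_afterSlab {a b c z : Plane} (hab : a ≠ b) (h0 : ori a b z = 0)
    (hz : z ∈ afterSlab a b) (hg : 0 < ori b c a) : ori b c z < 0 := by
  have hp := along_self_right_pos hab
  have h2 : 1 < along a b z / along a b b := (one_lt_div hp).mpr hz
  rw [eq_combo_of_ori_eq_zero hab h0, isAff_ori b c _ _ _ _ (by ring), ori_self_left]
  nlinarith

theorem ori_neg_of_beforeSlab {a b c z : Plane} (hab : a ≠ b) (h0 : ori a b z = 0)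
    (hz : z ∈ beforeSlab a b) (hg : 0 < ori c a b) : ori c a z < 0 := by
  have hp := along_self_right_pos hab
  have h2 : along a b z / along a b b < 0 := div_neg_of_neg_of_pos hz hp
  rw [eq_combo_of_ori_eq_zero hab h0, isAff_ori c a _ _ _ _ (by ring), ori_self_right]
  nlinarith

/-- A line `f = 0` with `a`, `b` on its positive side, entering the cap cut off by `a b`, stays in
the cap as long as it does not cross the lines `f₁ = 0` through `a` and `f₂ = 0` through `b`. -/
theorem ori_neg_of_cap {f f₁ f₂ : Plane → ℝ} (hf : IsAff f) (hf₁ : IsAff f₁) (hf₂ : IsAff f₂)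
    {a b y z : Plane} (hab : a ≠ b) (ha1 : f₁ a = 0) (hb1 : 0 < f₁ b) (ha2 : 0 < f₂ a)
    (hb2 : f₂ b = 0) (ha : 0 < f a) (hb : 0 < f b) (hy : f y = 0) (hy1 : 0 ≤ f₁ y)
    (hy2 : 0 ≤ f₂ y) (hyg : ori a b y < 0) (hz : f z = 0) (hz1 : 0 ≤ f₁ z) (hz2 : 0 ≤ f₂ z) :
    ori a b z < 0 := by
  -- Otherwise the segment from y to z meets the line ab at (1 - μ)a + μb. The signs of `f₁` and
  -- `f₂` give 0 ≤ μ ≤ 1, so f is positive there, although it vanishes at y and z.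
  by_contra hc
  rw [not_lt] at hc
  have hD : 0 < ori a b z - ori a b y := by linarith
  obtain ⟨s, t, hs, ht, hst, hx⟩ : ∃ s t : ℝ, 0 ≤ s ∧ 0 ≤ t ∧ s + t = 1 ∧
      ori a b (s • y + t • z) = 0 := by
    refine ⟨ori a b z / (ori a b z - ori a b y), - ori a b y / (ori a b z - ori a b y),
      by positivity, div_nonneg (by linarith) hD.le, ?_, ?_⟩
    · rw [← add_div, ← sub_eq_add_neg, div_self hD.ne']
    · rw [isAff_ori a b]
      · field_simp; ring
      · rw [← add_div, ← sub_eq_add_neg, div_self hD.ne']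
  have e := eq_combo_of_ori_eq_zero hab hx
  set μ := along a b (s • y + t • z) / along a b b
  have e0 := congrArg f e
  have e1 := congrArg f₁ e
  have e2 := congrArg f₂ e
  rw [hf _ _ _ _ hst, hf _ _ _ _ (by ring)] at e0
  rw [hf₁ _ _ _ _ hst, hf₁ _ _ _ _ (by ring)] at e1
  rw [hf₂ _ _ _ _ hst, hf₂ _ _ _ _ (by ring)] at e2
  have p1 : 0 ≤ μ * f₁ b := by
    have := add_nonneg (mul_nonneg hs hy1) (mul_nonneg ht hz1)
    rw [e1, ha1] at this; linarith
  have p2 : 0 ≤ (1 - μ) * f₂ a := by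
    have := add_nonneg (mul_nonneg hs hy2) (mul_nonneg ht hz2)
    rw [e2, hb2] at this; linarith
  have m1 : 0 ≤ μ := nonneg_of_mul_nonneg_left p1 hb1
  have m2 : 0 ≤ 1 - μ := nonneg_of_mul_nonneg_left p2 ha2
  rw [hy, hz] at e0
  rcases m1.eq_or_lt with h | h
  · rw [← h] at e0; linarith
  · have := mul_pos h hb
    have := mul_nonneg m2 ha.le
    linarith

/-- Four pairwise disjoint consecutive hull edges whose cap contains no other points remove eight
points: take the four outer half-planes, the cap, and the inner region. -/
theorem exists_remove_eight_of_cap {P : Finset Plane} {v₁ v₂ v₃ v₄ v₅ v₆ v₇ v₈ : Plane}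
    (e₁ : IsHullEdge P v₁ v₂) (e₂ : IsHullEdge P v₃ v₄) (e₃ : IsHullEdge P v₅ v₆)
    (e₄ : IsHullEdge P v₇ v₈) (hnd : [v₁, v₂, v₃, v₄, v₅, v₆, v₇, v₈].Nodup)
    (hcap : ∀ q ∈ P, ori v₂ v₇ q < 0 → q = v₃ ∨ q = v₄ ∨ q = v₅ ∨ q = v₆)
    (h₁ : 0 < ori v₂ v₇ v₁) (h₄ : ori v₂ v₇ v₄ < 0) (h₆ : ori v₂ v₇ v₆ < 0)
    (h₈ : 0 < ori v₂ v₇ v₈) :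
    ∃ Q ⊆ P, Q.card + 8 = P.card ∧
      ∀ k, CoveredByConvex k (Q : Set Plane)ᶜ → CoveredByConvex (k + 5) (P : Set Plane)ᶜ := by
  classical
  have hV : ([v₁, v₂, v₃, v₄, v₅, v₆, v₇, v₈].toFinset : Finset Plane) ⊆ P := by
    intro z hz
    simp only [List.mem_toFinset, List.mem_cons, List.not_mem_nil, or_false] at hz
    rcases hz with rfl | rfl | rfl | rfl | rfl | rfl | rfl | rfl
    exacts [e₁.1, e₁.2.1, e₂.1, e₂.2.1, e₃.1, e₃.2.1, e₄.1, e₄.2.1]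
  refine ⟨P \ [v₁, v₂, v₃, v₄, v₅, v₆, v₇, v₈].toFinset, Finset.sdiff_subset, ?_, fun k hk => ?_⟩
  · have := Finset.card_sdiff_add_card_eq_card hV
    rw [List.toFinset_card_of_nodup hnd] at this
    simpa using this
  -- Each edge line is split at its two vertices. The inner region takes the edge, the cap takes the
  -- ray that starts at v₂, v₄, v₆ or v₇ away from the edge, and the outer half-plane takes the
  -- other ray.
  set R : Set Plane := leftSide v₁ v₂ (midSlab v₁ v₂) ∩ leftSide v₃ v₄ (midSlab v₃ v₄) ∩
    leftSide v₅ v₆ (midSlab v₅ v₆) ∩ leftSide v₇ v₈ (midSlab v₇ v₈) with hR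
  set C : Set Plane := leftSide v₁ v₂ (afterSlab v₁ v₂) ∩ leftSide v₃ v₄ (afterSlab v₃ v₄) ∩
    leftSide v₅ v₆ (afterSlab v₅ v₆) ∩ leftSide v₇ v₈ (beforeSlab v₇ v₈) ∩
    {z | ori v₂ v₇ z < 0} with hC
  have cR : Convex ℝ R := (((convex_leftSide _ _ (convex_midSlab _ _)).inter
    (convex_leftSide _ _ (convex_midSlab _ _))).inter
    (convex_leftSide _ _ (convex_midSlab _ _))).inter (convex_leftSide _ _ (convex_midSlab _ _))
  have cC : Convex ℝ C := ((((convex_leftSide _ _ (convex_afterSlab _ _)).inter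
    (convex_leftSide _ _ (convex_afterSlab _ _))).inter
    (convex_leftSide _ _ (convex_afterSlab _ _))).inter
    (convex_leftSide _ _ (convex_beforeSlab _ _))).inter ((isAff_ori v₂ v₇).convex_lt _)
  have c1 := (convex_rightSide v₁ v₂ (convex_beforeSlab v₁ v₂)).coveredByConvex_compl_inter
    (e₁.notMem_rightSide (left_notMem_beforeSlab _ _) (right_notMem_beforeSlab e₁.2.2.1))
  have c2 := (convex_rightSide v₃ v₄ (convex_beforeSlab v₃ v₄)).coveredByConvex_compl_inter
    (e₂.notMem_rightSide (left_notMem_beforeSlab _ _) (right_notMem_beforeSlab e₂.2.2.1))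
  have c3 := (convex_rightSide v₅ v₆ (convex_beforeSlab v₅ v₆)).coveredByConvex_compl_inter
    (e₃.notMem_rightSide (left_notMem_beforeSlab _ _) (right_notMem_beforeSlab e₃.2.2.1))
  have c4 := (convex_rightSide v₇ v₈ (convex_afterSlab v₇ v₈)).coveredByConvex_compl_inter
    (e₄.notMem_rightSide (left_notMem_afterSlab e₄.2.2.1) (right_notMem_afterSlab _ _))
  have c5 : CoveredByConvex 1 ((P : Set Plane)ᶜ ∩ C) := by
    refine cC.coveredByConvex_compl_inter fun z hz hzC => ?_
    obtain ⟨⟨⟨⟨_, hz2⟩, hz3⟩, _⟩, hzg⟩ := hzC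
    rcases hcap z hz hzg with rfl | rfl | rfl | rfl
    · exact left_notMem_leftSide (left_notMem_afterSlab e₂.2.2.1) hz2
    · exact right_notMem_leftSide (right_notMem_afterSlab _ _) hz2
    · exact left_notMem_leftSide (left_notMem_afterSlab e₃.2.2.1) hz3
    · exact right_notMem_leftSide (right_notMem_afterSlab _ _) hz3
  have c6 : CoveredByConvex k ((P : Set Plane)ᶜ ∩ R) := by
    refine hk.compl_inter cR Finset.sdiff_subset fun z hz hzR => ?_
    obtain ⟨⟨⟨hz1, hz2⟩, hz3⟩, hz4⟩ := hzR
    refine Finset.mem_sdiff.mpr ⟨hz, ?_⟩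
    simp only [List.mem_toFinset, List.mem_cons, List.not_mem_nil, or_false]
    rintro (rfl | rfl | rfl | rfl | rfl | rfl | rfl | rfl)
    · exact left_notMem_leftSide (left_notMem_midSlab _ _) hz1
    · exact right_notMem_leftSide (right_notMem_midSlab _ _) hz1
    · exact left_notMem_leftSide (left_notMem_midSlab _ _) hz2
    · exact right_notMem_leftSide (right_notMem_midSlab _ _) hz2
    · exact left_notMem_leftSide (left_notMem_midSlab _ _) hz3
    · exact right_notMem_leftSide (right_notMem_midSlab _ _) hz3
    · exact left_notMem_leftSide (left_notMem_midSlab _ _) hz4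
    · exact right_notMem_leftSide (right_notMem_midSlab _ _) hz4
  convert c6.union (c5.union (c4.union (c3.union (c2.union c1)))) using 1
  ext z
  simp only [Set.mem_union, Set.mem_inter_iff, ← and_or_left]
  refine ⟨fun hz => ⟨hz, ?_⟩, And.left⟩
  by_contra hcon
  simp only [not_or] at hcon
  obtain ⟨nR, nC, n4, n3, n2, n1⟩ := hcon
  have hne : ∀ v ∈ P, z ≠ v := fun v hv h => hz (by rw [h]; exact hv)
  have split : ∀ {a b : Plane}, IsHullEdge P a b → z ∉ rightSide a b (beforeSlab a b) →
      0 < ori a b z ∨ (ori a b z = 0 ∧ (z ∈ midSlab a b ∨ z ∈ afterSlab a b)) := by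
    intro a b e hn
    rcases lt_trichotomy (ori a b z) 0 with h | h | h
    · exact (hn (Or.inl h)).elim
    · refine Or.inr ⟨h, ?_⟩
      rcases mem_slab_cases e.2.2.1 h (hne a e.1) (hne b e.2.1) with h' | h'
      · exact (hn (Or.inr ⟨h, h'⟩)).elim
      · exact h'
    · exact Or.inl h
  have s1 := split e₁ n1
  have s2 := split e₂ n2
  have s3 := split e₃ n3
  have s4 : 0 < ori v₇ v₈ z ∨ (ori v₇ v₈ z = 0 ∧ (z ∈ midSlab v₇ v₈ ∨ z ∈ beforeSlab v₇ v₈)) := by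
    rcases lt_trichotomy (ori v₇ v₈ z) 0 with h | h | h
    · exact (n4 (Or.inl h)).elim
    · refine Or.inr ⟨h, ?_⟩
      rcases mem_slab_cases e₄.2.2.1 h (hne _ e₄.1) (hne _ e₄.2.1) with h' | h' | h'
      · exact Or.inr h'
      · exact Or.inl h'
      · exact (n4 (Or.inr ⟨h, h'⟩)).elim
    · exact Or.inl h
  simp only [List.nodup_cons, List.mem_cons, List.not_mem_nil, or_false, not_or] at hnd
  obtain ⟨⟨d12, d13, d14, d15, d16, d17, d18⟩, ⟨d23, d24, d25, d26, d27, d28⟩,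
    ⟨d34, d35, d36, d37, d38⟩, ⟨d45, d46, d47, d48⟩, ⟨d56, d57, d58⟩, ⟨d67, d68⟩, d78, _⟩ := hnd
  have key : ∀ {a b : Plane}, a ∈ P → b ∈ P → a ≠ b → ori a b z = 0 → z ∈ midSlab a b →
      ∀ {c d : Plane}, IsHullEdge P c d → a ≠ c → a ≠ d → b ≠ c → b ≠ d → 0 < ori c d z :=
    fun ha hb hab h0 hm _ _ e h1 h2 h3 h4 => e.ori_pos_of_midSlab ha hb hab h1 h2 h3 h4 h0 hm
  -- A point in the relative interior of one of the edges lies in the inner region.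
  have m1 : ¬ (ori v₁ v₂ z = 0 ∧ z ∈ midSlab v₁ v₂) := fun ⟨h0, hm⟩ =>
    nR ⟨⟨⟨Or.inr ⟨h0, hm⟩, Or.inl (key e₁.1 e₁.2.1 d12 h0 hm e₂ d13 d14 d23 d24)⟩,
      Or.inl (key e₁.1 e₁.2.1 d12 h0 hm e₃ d15 d16 d25 d26)⟩,
      Or.inl (key e₁.1 e₁.2.1 d12 h0 hm e₄ d17 d18 d27 d28)⟩
  have m2 : ¬ (ori v₃ v₄ z = 0 ∧ z ∈ midSlab v₃ v₄) := fun ⟨h0, hm⟩ =>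
    nR ⟨⟨⟨Or.inl (key e₂.1 e₂.2.1 d34 h0 hm e₁ (Ne.symm d13) (Ne.symm d23) (Ne.symm d14)
      (Ne.symm d24)), Or.inr ⟨h0, hm⟩⟩,
      Or.inl (key e₂.1 e₂.2.1 d34 h0 hm e₃ d35 d36 d45 d46)⟩,
      Or.inl (key e₂.1 e₂.2.1 d34 h0 hm e₄ d37 d38 d47 d48)⟩
  have m3 : ¬ (ori v₅ v₆ z = 0 ∧ z ∈ midSlab v₅ v₆) := fun ⟨h0, hm⟩ =>
    nR ⟨⟨⟨Or.inl (key e₃.1 e₃.2.1 d56 h0 hm e₁ (Ne.symm d15) (Ne.symm d25) (Ne.symm d16)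
      (Ne.symm d26)), Or.inl (key e₃.1 e₃.2.1 d56 h0 hm e₂ (Ne.symm d35) (Ne.symm d45)
      (Ne.symm d36) (Ne.symm d46))⟩, Or.inr ⟨h0, hm⟩⟩,
      Or.inl (key e₃.1 e₃.2.1 d56 h0 hm e₄ d57 d58 d67 d68)⟩
  have m4 : ¬ (ori v₇ v₈ z = 0 ∧ z ∈ midSlab v₇ v₈) := fun ⟨h0, hm⟩ =>
    nR ⟨⟨⟨Or.inl (key e₄.1 e₄.2.1 d78 h0 hm e₁ (Ne.symm d17) (Ne.symm d27) (Ne.symm d18)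
      (Ne.symm d28)), Or.inl (key e₄.1 e₄.2.1 d78 h0 hm e₂ (Ne.symm d37) (Ne.symm d47)
      (Ne.symm d38) (Ne.symm d48))⟩, Or.inl (key e₄.1 e₄.2.1 d78 h0 hm e₃ (Ne.symm d57)
      (Ne.symm d67) (Ne.symm d58) (Ne.symm d68))⟩, Or.inr ⟨h0, hm⟩⟩
  have t1 : z ∈ leftSide v₁ v₂ (afterSlab v₁ v₂) :=
    s1.imp id fun ⟨h0, h⟩ => ⟨h0, h.resolve_left fun hm => m1 ⟨h0, hm⟩⟩
  have t2 : z ∈ leftSide v₃ v₄ (afterSlab v₃ v₄) :=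
    s2.imp id fun ⟨h0, h⟩ => ⟨h0, h.resolve_left fun hm => m2 ⟨h0, hm⟩⟩
  have t3 : z ∈ leftSide v₅ v₆ (afterSlab v₅ v₆) :=
    s3.imp id fun ⟨h0, h⟩ => ⟨h0, h.resolve_left fun hm => m3 ⟨h0, hm⟩⟩
  have t4 : z ∈ leftSide v₇ v₈ (beforeSlab v₇ v₈) :=
    s4.imp id fun ⟨h0, h⟩ => ⟨h0, h.resolve_left fun hm => m4 ⟨h0, hm⟩⟩
  have p1 : 0 ≤ ori v₁ v₂ z := t1.elim le_of_lt fun h => h.1.ge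
  have p4 : 0 ≤ ori v₇ v₈ z := t4.elim le_of_lt fun h => h.1.ge
  -- Being outside R, z must lie on one of the rays allotted to the cap; each of the four cases
  -- places it to the right of v₂ → v₇.
  have fin : ¬ ori v₂ v₇ z < 0 := fun hg => nC ⟨⟨⟨⟨t1, t2⟩, t3⟩, t4⟩, hg⟩
  have q1 : 0 < ori v₁ v₂ v₇ := e₁.2.2.2 _ e₄.1 (Ne.symm d17) (Ne.symm d27)
  have q2 : 0 < ori v₇ v₈ v₂ := e₄.2.2.2 _ e₁.2.1 d27 d28
  rcases t1 with t1 | t1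
  · rcases t2 with t2 | t2
    · rcases t3 with t3 | t3
      · rcases t4 with t4 | t4
        · exact nR ⟨⟨⟨Or.inl t1, Or.inl t2⟩, Or.inl t3⟩, Or.inl t4⟩
        · exact fin (ori_neg_of_beforeSlab d78 t4.1 t4.2 h₈)
      · exact fin (ori_neg_of_cap (isAff_ori v₅ v₆) (isAff_ori v₁ v₂) (isAff_ori v₇ v₈) d27
          (ori_self_right _ _) q1 q2 (ori_self_left _ _) (e₃.2.2.2 _ e₁.2.1 d25 d26)
          (e₃.2.2.2 _ e₄.1 (Ne.symm d57) (Ne.symm d67)) (ori_self_right v₅ v₆)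
          (e₁.ori_nonneg e₃.2.1) (e₄.ori_nonneg e₃.2.1) h₆ t3.1 p1 p4)
    · exact fin (ori_neg_of_cap (isAff_ori v₃ v₄) (isAff_ori v₁ v₂) (isAff_ori v₇ v₈) d27
        (ori_self_right _ _) q1 q2 (ori_self_left _ _) (e₂.2.2.2 _ e₁.2.1 d23 d24)
        (e₂.2.2.2 _ e₄.1 (Ne.symm d37) (Ne.symm d47)) (ori_self_right v₃ v₄)
        (e₁.ori_nonneg e₂.2.1) (e₄.ori_nonneg e₂.2.1) h₄ t2.1 p1 p4)
  · exact fin (ori_neg_of_afterSlab d12 t1.1 t1.2 h₁)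

/-! ### Rays from a hull edge through two points -/

/-- Eight points of `P` can be removed at the cost of five convex sets. -/
def EightRemovable (P : Finset Plane) : Prop :=
  ∃ Q ⊆ P, Q.card + 8 = P.card ∧
    ∀ k, CoveredByConvex k (Q : Set Plane)ᶜ → CoveredByConvex (k + 5) (P : Set Plane)ᶜ

/-- The linear relation between the plane vectors x - m, y - m, z - m, mapped by the linear part of
`ori a b`. -/
theorem ori_pluecker (a b m x y z : Plane) :
    (ori a b x - ori a b m) * ori m y z + (ori a b y - ori a b m) * ori m z x +
      (ori a b z - ori a b m) * ori m x y = 0 := by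
  simp only [ori]; ring

theorem ori_eq_add (m x y z : Plane) : ori x y z = ori m x y + ori m y z + ori m z x := by
  simp only [ori]; ring

theorem eq_of_ori_of_ori {a b m p z w : Plane} (hD : ori a b p - ori a b m ≠ 0)
    (h1 : ori a b z = ori a b w) (h2 : ori m p z = ori m p w) : z = w := by
  simp only [ori] at h1 h2 hD
  apply plane_ext
  · apply mul_left_cancel₀ hD
    linear_combination (p 0 - m 0) * h1 - (b 0 - a 0) * h2
  · apply mul_left_cancel₀ hD
    linear_combination (p 1 - m 1) * h1 - (b 1 - a 1) * h2

theorem eightRemovable_of_ray {P W : Finset Plane} (hP : InGeneralPosition (P : Set Plane))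
    {a b p q : Plane} (e : IsHullEdge P a b) {t : ℝ} (ht0 : 0 < t) (ht1 : t < 1)
    (hp : p ∈ P) (hq : q ∈ P) (hpa : p ≠ a) (hpb : p ≠ b)
    (hm : ori ((1 - t) • a + t • b) p q = 0) (hpq : ori a b p < ori a b q) (hWP : W ⊆ P)
    (hW : W.card = 4) (hWr : ∀ w ∈ W, w ≠ b ∧ ori ((1 - t) • a + t • b) p w < 0)
    (hPr : ∀ z ∈ P, z ∉ W → z ≠ a → z ≠ b → z ≠ p → z ≠ q →
      0 < ori ((1 - t) • a + t • b) p z) : EightRemovable P := by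
  have hp0 := e.2.2.2 p hp hpa hpb
  have hm0 : ori a b ((1 - t) • a + t • b) = 0 := by
    rw [isAff_ori a b _ _ _ _ (by ring), ori_self_left, ori_self_right]; ring
  have ra : ori ((1 - t) • a + t • b) p a = t * ori a b p := by
    simp only [ori, PiLp.add_apply, PiLp.smul_apply, smul_eq_mul]; ring
  have rb : ori ((1 - t) • a + t • b) p b = - ((1 - t) * ori a b p) := by
    simp only [ori, PiLp.add_apply, PiLp.smul_apply, smul_eq_mul]; ring
  have ra' : 0 < ori ((1 - t) • a + t • b) p a := by rw [ra]; positivity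
  have rb' : ori ((1 - t) • a + t • b) p b < 0 := by
    rw [rb]; exact neg_neg_of_pos (mul_pos (by linarith) hp0)
  refine exists_remove_eight_of_coordinates hP (isAff_ori a b)
    (isAff_ori ((1 - t) • a + t • b) p)
    (fun z w h1 h2 => eq_of_ori_of_ori (by rw [hm0]; linarith) h1 h2) e.1 e.2.1 hp hq
    (ori_self_left a b) (ori_self_right a b) ra' rb' (ori_self_right _ _) hm hp0 hpq e.2.2.2
    hWP hW hWr ?_
  intro z hz hzW hzb hzp hzq
  by_cases hza : z = a
  · rw [hza]; exact ra'
  · exact hPr z hz hzW hza hzb hzp hzq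

/-- If the first five points seen from `a` are not the first five seen from `b`, then at some
moment a point moving from `a` to `b` sees the fifth and the sixth point in the same direction. -/
theorem eightRemovable_of_swap {P T : Finset Plane} (hP : InGeneralPosition (P : Set Plane))
    {a b : Plane} (e : IsHullEdge P a b) (hTP : T ⊆ P) (haT : a ∉ T) (hbT : b ∉ T)
    (hT : T.card = 5) (hTa : ∀ x ∈ T, ∀ y ∈ P, y ∉ T → y ≠ a → y ≠ b → 0 < ori a x y)
    (hTb : ∃ x ∈ T, ∃ y ∈ P, y ∉ T ∧ y ≠ a ∧ y ≠ b ∧ ori b x y < 0) : EightRemovable P := by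
  classical
  set U : Finset (Plane × Plane) := (T ×ˢ P).filter
    (fun z => z.2 ∉ T ∧ z.2 ≠ a ∧ z.2 ≠ b ∧ ori b z.1 z.2 < 0) with hU
  obtain ⟨x₀, hx₀, y₀, hy₀, hy₀'⟩ := hTb
  -- Along the edge `ori m x y` is affine in the time t; the minimised ratio is its zero, so (x, y)
  -- is a pair that is exchanged first.
  obtain ⟨⟨x, y⟩, hxy, hmin⟩ := Finset.exists_min_image U
    (fun z => ori a z.1 z.2 / (ori a z.1 z.2 - ori b z.1 z.2))
    ⟨(x₀, y₀), by simp only [hU, Finset.mem_filter, Finset.mem_product]; exact ⟨⟨hx₀, hy₀⟩, hy₀'⟩⟩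
  simp only [hU, Finset.mem_filter, Finset.mem_product] at hxy
  obtain ⟨⟨hx, hy⟩, hyT, hya, hyb, hneg⟩ := hxy
  have hpos := hTa x hx y hy hyT hya hyb
  have hD : 0 < ori a x y - ori b x y := by linarith
  obtain ⟨t, htdef⟩ : ∃ t, t = ori a x y / (ori a x y - ori b x y) := ⟨_, rfl⟩
  have ht0 : 0 < t := by rw [htdef]; positivity
  have ht1 : t < 1 := by rw [htdef, div_lt_one hD]; linarith
  have hmove : ∀ u v, ori ((1 - t) • a + t • b) u v = (1 - t) * ori a u v + t * ori b u v := by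
    intro u v
    simp only [ori, PiLp.add_apply, PiLp.smul_apply, smul_eq_mul]; ring
  have hzero : ori ((1 - t) • a + t • b) x y = 0 := by
    rw [hmove, htdef]; field_simp; ring
  have hnn : ∀ u ∈ T, ∀ v ∈ P, v ∉ T → v ≠ a → v ≠ b →
      0 ≤ ori ((1 - t) • a + t • b) u v := by
    intro u hu v hv hvT hva hvb
    have hp := hTa u hu v hv hvT hva hvb
    rw [hmove]
    rcases lt_or_ge (ori b u v) 0 with h | h
    · have h1 := hmin (u, v) (by
        simp only [hU, Finset.mem_filter, Finset.mem_product]; exact ⟨⟨hu, hv⟩, hvT, hva, hvb, h⟩)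
      simp only [← htdef] at h1
      rw [le_div_iff₀ (by linarith)] at h1
      linarith
    · have := mul_pos (sub_pos.mpr ht1) hp
      have := mul_nonneg ht0.le h
      linarith
  have hm0 : ori a b ((1 - t) • a + t • b) = 0 := by
    rw [isAff_ori a b _ _ _ _ (by ring), ori_self_left, ori_self_right]; ring
  set m : Plane := (1 - t) • a + t • b with hmdef
  have hTh : ∀ u ∈ T, 0 < ori a b u := fun u hu => e.2.2.2 u (hTP hu)
    (fun h => haT (h ▸ hu)) (fun h => hbT (h ▸ hu))
  have hyh : 0 < ori a b y := e.2.2.2 y hy hya hyb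
  have hxh := hTh x hx
  have hxyne : x ≠ y := fun h => hyT (h ▸ hx)
  have hyx : ori m y x = 0 := by rw [ori_swap, hzero, neg_zero]
  -- Seen from m, x and y lie in the same direction, so they see every z on the same side.
  have hprop : ∀ z, ori a b y * ori m x z = ori a b x * ori m y z := by
    intro z
    have := ori_pluecker a b m x y z
    rw [hm0, hzero, ori_swap m x z] at this
    linear_combination -this
  have hthird : ∀ z ∈ P, z ≠ x → z ≠ y → ori m x z ≠ 0 := by
    intro z hz hzx hzy h0
    have h1 : ori m y z = 0 := by
      have := hprop z
      rw [h0, mul_zero] at this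
      exact (mul_eq_zero.mp this.symm).resolve_left hxh.ne'
    refine hP.ori_ne_zero (hTP hx) hy hz hxyne (Ne.symm hzy) (Ne.symm hzx) ?_
    rw [ori_eq_add m, hzero, h1, ori_swap m x z, h0]; ring
  have hleft : ∀ z ∈ P, z ∉ T → z ≠ a → z ≠ b → z ≠ y → 0 < ori m x z := by
    intro z hz hzT hza hzb hzy
    exact lt_of_le_of_ne (hnn x hx z hz hzT hza hzb)
      (Ne.symm (hthird z hz (fun h => hzT (h ▸ hx)) hzy))
  have hright : ∀ z ∈ T, z ≠ x → ori m x z < 0 := by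
    intro z hz hzx
    have h1 := hnn z hz y hy hyT hya hyb
    have h2 : ori m y z ≤ 0 := by rw [ori_swap]; linarith
    have h3 := hprop z
    have h4 : ori m x z ≤ 0 := by
      by_contra hc
      push Not at hc
      have := mul_pos hyh hc
      have := mul_nonpos_of_nonneg_of_nonpos hxh.le h2
      linarith
    exact lt_of_le_of_ne h4 (hthird z (hTP hz) hzx (fun h => hyT (h ▸ hz)))
  have hleft' : ∀ z ∈ P, z ∉ T → z ≠ a → z ≠ b → z ≠ y → 0 < ori m y z := by
    intro z hz hzT hza hzb hzy
    have := mul_pos hyh (hleft z hz hzT hza hzb hzy)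
    rw [hprop] at this
    exact pos_of_mul_pos_right this hxh.le
  have hright' : ∀ z ∈ T, z ≠ x → ori m y z < 0 := by
    intro z hz hzx
    have := mul_neg_of_pos_of_neg hyh (hright z hz hzx)
    rw [hprop] at this
    exact (pos_iff_neg_of_mul_neg this).mp hxh
  have hWsub : T.erase x ⊆ P := (Finset.erase_subset _ _).trans hTP
  have hWc : (T.erase x).card = 4 := by rw [Finset.card_erase_of_mem hx, hT]
  have hxa : x ≠ a := fun h => haT (h ▸ hx)
  have hxb : x ≠ b := fun h => hbT (h ▸ hx)
  have hTz : ∀ {z}, z ∉ T.erase x → z ≠ x → z ∉ T := fun h1 h2 h3 =>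
    h1 (Finset.mem_erase.mpr ⟨h2, h3⟩)
  have hWb : ∀ w ∈ T.erase x, w ≠ b := fun w hw h => hbT (h ▸ (Finset.mem_of_mem_erase hw))
  -- Whichever of x and y is nearer to the edge plays the part of p.
  rcases lt_trichotomy (ori a b x) (ori a b y) with hlt | heq | hlt
  · exact eightRemovable_of_ray hP e ht0 ht1 (hTP hx) hy hxa hxb hzero hlt hWsub hWc
      (fun w hw => ⟨hWb w hw, hright w (Finset.mem_of_mem_erase hw) (Finset.ne_of_mem_erase hw)⟩)
      (fun z hz hzW hza hzb hzx hzy => hleft z hz (hTz hzW hzx) hza hzb hzy)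
  · exact (hxyne (eq_of_ori_of_ori (a := a) (b := b) (m := m) (p := x) (by rw [hm0]; linarith) heq
      (by rw [ori_self_right, hzero]))).elim
  · exact eightRemovable_of_ray hP e ht0 ht1 hy (hTP hx) hya hyb hyx hlt hWsub hWc
      (fun w hw => ⟨hWb w hw, hright' w (Finset.mem_of_mem_erase hw) (Finset.ne_of_mem_erase hw)⟩)
      (fun z hz hzW hza hzb hzy hzx => hleft' z hz (hTz hzW hzx) hza hzb hzy)

/-! ### Points seen early from a hull vertex -/

open Classical in
/-- The points of `P` to the right of `v → u`. -/
noncomputable def rightOf (P : Finset Plane) (v u : Plane) : Finset Plane :=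
  P.filter (fun q => ori v u q < 0)

theorem mem_rightOf {P : Finset Plane} {v u q : Plane} :
    q ∈ rightOf P v u ↔ q ∈ P ∧ ori v u q < 0 := by
  simp [rightOf]

theorem IsHullEdge.card_rightOf_le {P : Finset Plane} (hP : InGeneralPosition (P : Set Plane))
    (hno : ¬ EightRemovable P) (hc : 7 ≤ P.card) {a b u : Plane} (e : IsHullEdge P a b)
    (hu : u ∈ P) (hua : u ≠ a) (hub : u ≠ b) (hr : (rightOf P a u).card ≤ 5) :
    (rightOf P b u).card ≤ 4 := by
  classical
  obtain ⟨key, hkey⟩ := exists_angular_key a (b 0 - a 0) (b 1 - a 1)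
  have hb' : b ∈ P.erase a := Finset.mem_erase.mpr ⟨e.2.2.1.symm, e.2.1⟩
  obtain ⟨T, hTS, hT, hTk⟩ := exists_top_subset key 5 ((P.erase a).erase b) (by
    rw [Finset.card_erase_of_mem hb', Finset.card_erase_of_mem e.1]; omega)
  have hTP : T ⊆ P := hTS.trans ((Finset.erase_subset _ _).trans (Finset.erase_subset _ _))
  have haT : a ∉ T := fun h => by simpa using hTS h
  have hbT : b ∉ T := fun h => by simpa using hTS h
  have hTa : ∀ x ∈ T, ∀ y ∈ P, y ∉ T → y ≠ a → y ≠ b → 0 < ori a x y := by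
    intro x hx y hy hyT hya hyb
    have hxa : x ≠ a := fun h => haT (h ▸ hx)
    have hxb : x ≠ b := fun h => hbT (h ▸ hx)
    have h1 := (hkey x y (e.2.2.2 x (hTP hx) hxa hxb) (e.2.2.2 y hy hya hyb)).mp
      (hTk x hx y (by simp only [Finset.mem_erase]; exact ⟨hyb, hya, hy⟩) hyT)
    exact lt_of_le_of_ne h1 (Ne.symm (hP.ori_ne_zero e.1 (hTP hx) hy hxa.symm
      (fun h => hyT (h ▸ hx)) hya.symm))
  have hTb : ∀ x ∈ T, ∀ y ∈ P, y ∉ T → y ≠ a → y ≠ b → 0 ≤ ori b x y := by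
    intro x hx y hy hyT hya hyb
    by_contra hneg
    exact hno (eightRemovable_of_swap hP e hTP haT hbT hT hTa
      ⟨x, hx, y, hy, hyT, hya, hyb, not_le.mp hneg⟩)
  -- Otherwise b and the five points of T, six in all, would lie to the right of a → u.
  have huT : u ∈ T := by
    by_contra huT
    have hsub : insert b T ⊆ rightOf P a u := by
      intro q hq
      rw [mem_rightOf, ori_swap]
      rcases Finset.mem_insert.mp hq with rfl | hq
      · exact ⟨e.2.1, by linarith [e.2.2.2 u hu hua hub]⟩
      · exact ⟨hTP hq, by linarith [hTa q hq u hu huT hua hub]⟩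
    have := Finset.card_le_card hsub
    rw [Finset.card_insert_of_notMem hbT] at this
    omega
  have hsub : rightOf P b u ⊆ T.erase u := by
    intro q hq
    rw [mem_rightOf] at hq
    refine Finset.mem_erase.mpr ⟨?_, ?_⟩
    · rintro rfl; linarith [ori_self_right b q, hq.2]
    · by_contra hqT
      by_cases hqa : q = a
      · rw [hqa, ori_rotate] at hq
        linarith [e.2.2.2 u hu hua hub, hq.2]
      by_cases hqb : q = b
      · rw [hqb, ori_self_left] at hq; linarith [hq.2]
      linarith [hTb u huT q hq.1 hqT hqa hqb, hq.2]
  have := Finset.card_le_card hsub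
  rw [Finset.card_erase_of_mem huT] at this
  omega

/-- A point with at most five points to the right of the ray from some hull vertex is itself a hull
vertex: otherwise this property spreads to all hull vertices, three of which surround the point. -/
theorem IsHullVertex.of_card_rightOf_le {P : Finset Plane}
    (hP : InGeneralPosition (P : Set Plane)) (hno : ¬ EightRemovable P) (hc : 17 ≤ P.card)
    {v u : Plane} (hv : IsHullVertex P v) (hu : u ∈ P) (huv : u ≠ v)
    (hr : (rightOf P v u).card ≤ 5) : IsHullVertex P u := by
  classical
  by_contra hnu
  have hne : ∀ {x}, IsHullVertex P x → u ≠ x := fun hx h => hnu (h ▸ hx)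
  set S : Finset Plane := P.filter
    (fun x => IsHullVertex P x ∧ (rightOf P x u).card ≤ 5 ∧ ori v u x < 0) with hS
  have hnext : ∀ {x}, IsHullVertex P x → (rightOf P x u).card ≤ 5 →
      ∃ y, IsHullEdge P x y ∧ IsHullVertex P y ∧ (rightOf P y u).card ≤ 5 := by
    rintro x ⟨y, e⟩ hx
    have hy : IsHullVertex P y := e.exists_next hP (by omega)
    exact ⟨y, e, hy,
      (e.card_rightOf_le hP hno (by omega) hu (hne ⟨y, e⟩) (hne hy) hx).trans (by omega)⟩
  have hfwd : ∀ {x y}, IsHullEdge P x y → IsHullVertex P y → 0 < ori x y u := fun e hy =>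
    e.2.2.2 u hu (hne ⟨_, e⟩) (hne hy)
  obtain ⟨b, eb, hb, hbr⟩ := hnext hv hr
  have hbS : b ∈ S := by
    simp only [hS, Finset.mem_filter]
    exact ⟨eb.2.1, hb, hbr, by rw [ori_swap]; linarith [hfwd eb hb]⟩
  obtain ⟨key, hkey⟩ := exists_angular_key u (v 0 - u 0) (v 1 - u 1)
  have hside : ∀ x ∈ S, 0 < ori u v x := by
    intro x hx
    simp only [hS, Finset.mem_filter] at hx
    rw [ori_swap']; linarith [hx.2.2.2]
  -- x is the last such vertex counterclockwise around u from v, so its successor y is across the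
  -- line vu, and u lies inside the triangle v x y.
  obtain ⟨x, hxS, hxmin⟩ := Finset.exists_min_image S key ⟨b, hbS⟩
  have hxS' := hxS
  simp only [hS, Finset.mem_filter] at hxS'
  obtain ⟨hxP, hx, hxr, hxv⟩ := hxS'
  obtain ⟨y, ey, hy, hyr⟩ := hnext hx hxr
  have hxy := hfwd ey hy
  have hyv : y ≠ v := by
    rintro rfl
    rw [← ori_rotate] at hxv
    rw [← ori_rotate] at hxv
    linarith
  have hyS : y ∉ S := by
    intro h2
    have h1 := (hkey y x (hside y h2) (hside x hxS)).mp (hxmin y h2)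
    rw [ori_swap, ← ori_rotate] at h1
    linarith
  have hvy : 0 < ori v u y := by
    have h1 : ¬ ori v u y < 0 := fun h => hyS (by
      simp only [hS, Finset.mem_filter]; exact ⟨ey.2.1, hy, hyr, h⟩)
    exact lt_of_le_of_ne (not_lt.mp h1) (Ne.symm (hP.ori_ne_zero eb.1 hu ey.2.1 huv.symm
      (hne hy) hyv.symm))
  have hcover : P.erase u ⊆ rightOf P v u ∪ (rightOf P x u ∪ rightOf P y u) := by
    intro q hq
    obtain ⟨hqu, hqP⟩ := Finset.mem_erase.mp hq
    by_contra hcon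
    simp only [Finset.mem_union, mem_rightOf, not_or, not_and, not_lt] at hcon
    have c1 := hcon.1 hqP
    have c2 := hcon.2.1 hqP
    have c3 := hcon.2.2 hqP
    -- With positive weights the three signed areas sum to zero: a point other than u cannot be
    -- weakly left of all three rays. Hence P has at most 1 + 3 · 5 = 16 points.
    have hid : ori x y u * ori v u q + ori v u y * ori x u q + (- ori v u x) * ori y u q = 0 := by
      simp only [ori]; ring
    have p1 := mul_nonneg hxy.le c1
    have p2 := mul_nonneg hvy.le c2
    have p3 := mul_nonneg (neg_pos.mpr hxv).le c3
    have z1 : ori v u q = 0 := (mul_eq_zero.mp (by linarith : ori x y u * ori v u q = 0)).resolve_left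
      hxy.ne'
    have z2 : ori x u q = 0 := (mul_eq_zero.mp (by linarith : ori v u y * ori x u q = 0)).resolve_left
      hvy.ne'
    apply hqu
    refine eq_of_ori_of_ori (a := v) (b := u) (m := u) (p := x) ?_ ?_ ?_
    · rw [ori_self_right]; linarith
    · rw [z1, ori_self_right]
    · rw [ori_swap', z2, ori_self_left, neg_zero]
  have h1 := Finset.card_le_card hcover
  rw [Finset.card_erase_of_mem hu] at h1
  have h2 := Finset.card_union_le (rightOf P v u) (rightOf P x u ∪ rightOf P y u)
  have h3 := Finset.card_union_le (rightOf P x u) (rightOf P y u)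
  omega

/-! ### Consecutive hull vertices -/

/-- P lies on one side of a line through v, which makes the angular comparison around v linear
rather than cyclic. -/
theorem IsHullEdge.angular_trans {P : Finset Plane} {v b x y z : Plane} (e : IsHullEdge P v b)
    (hx : x ∈ P) (hy : y ∈ P) (hz : z ∈ P) (hxy : 0 < ori v x y) (hyz : 0 < ori v y z) :
    0 < ori v x z := by
  have later : ∀ {s t}, s ∈ P → t ∈ P → 0 < ori v s t → 0 < ori v b t := by
    intro s t hs ht hst
    refine e.2.2.2 t ht ?_ ?_
    · rintro rfl; rw [ori_self_left] at hst; exact lt_irrefl _ hst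
    · rintro rfl
      rw [ori_swap] at hst
      linarith [e.ori_nonneg hs]
  have h1 := later hx hy hxy
  have h2 := later hy hz hyz
  have h3 := ori_pluecker v b v x y z
  rw [ori_self_left, ori_swap v x z] at h3
  have h4 := mul_nonneg (e.ori_nonneg hx) hyz.le
  have h5 := mul_pos h2 hxy
  have h6 : 0 < ori v b y * ori v x z := by linarith
  exact pos_of_mul_pos_right h6 h1.le

/-- `ori c d` is nonnegative at the corners and zero at c, a positive combination of them; so it
vanishes at x and y, forcing both to equal d. -/
theorem IsHullVertex.not_in_triangle {P : Finset Plane} {c x y z : Plane} (hc : IsHullVertex P c)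
    (hx : x ∈ P) (hy : y ∈ P) (hz : z ∈ P) (h1 : 0 < ori x y c) (h2 : 0 < ori y z c)
    (h3 : 0 < ori z x c) : False := by
  obtain ⟨d, e⟩ := hc
  have hid : ori y z c * ori c d x + ori z x c * ori c d y + ori x y c * ori c d z = 0 := by
    simp only [ori]; ring
  have p1 := mul_nonneg h2.le (e.ori_nonneg hx)
  have p2 := mul_nonneg h3.le (e.ori_nonneg hy)
  have p3 := mul_nonneg h1.le (e.ori_nonneg hz)
  have z1 : ori c d x = 0 :=
    (mul_eq_zero.mp (by linarith : ori y z c * ori c d x = 0)).resolve_left h2.ne'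
  have z2 : ori c d y = 0 :=
    (mul_eq_zero.mp (by linarith : ori z x c * ori c d y = 0)).resolve_left h3.ne'
  have hxd : x = d := by
    by_contra hxd
    refine (e.2.2.2 x hx ?_ hxd).ne' z1
    rintro rfl; rw [ori_self_left] at h1; exact lt_irrefl _ h1
  have hyd : y = d := by
    by_contra hyd
    refine (e.2.2.2 y hy ?_ hyd).ne' z2
    rintro rfl; rw [ori_self_right] at h1; exact lt_irrefl _ h1
  rw [hxd, hyd] at h1
  simp [ori] at h1

/-- `S` is the set of points of `P` to the right of `v → w`. -/
def CutsOff (P : Finset Plane) (v w : Plane) (S : Finset Plane) : Prop :=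
  w ∈ P ∧ w ≠ v ∧ S ⊆ P ∧ ∀ q ∈ P, ori v w q < 0 ↔ q ∈ S

theorem CutsOff.right_notMem {P S : Finset Plane} {v w : Plane} (h : CutsOff P v w S) : w ∉ S :=
  fun hw => by
    have := (h.2.2.2 w h.1).mpr hw
    rw [ori_self_right] at this
    exact lt_irrefl _ this

/-- If w preceded v on the hull, every further point would be to the right of v → w. This keeps the
walk along the hull from closing up too early. -/
theorem CutsOff.ne_of_hullEdge {P S : Finset Plane} {v w x : Plane} (h : CutsOff P v w S)
    (e : IsHullEdge P x v) (hS : S.card + 3 ≤ P.card) : x ≠ w := by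
  classical
  rintro rfl
  have hsub : P ⊆ insert x (insert v S) := by
    intro q hq
    simp only [Finset.mem_insert]
    by_contra hcon
    push Not at hcon
    refine hcon.2.2 ((h.2.2.2 q hq).mp ?_)
    rw [ori_swap']
    linarith [e.2.2.2 q hq hcon.1 hcon.2.1]
  have h1 := Finset.card_le_card hsub
  have h2 := Finset.card_insert_le x (insert v S)
  have h3 := Finset.card_insert_le v S
  omega

/-- The angularly first stray point to the right of v → w' has at most the five points of S and w on
its right, so it is a hull vertex; but it lies inside the triangle v w w'. -/
theorem CutsOff.next [DecidableEq Plane] {P S : Finset Plane}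
    (hP : InGeneralPosition (P : Set Plane)) (hno : ¬ EightRemovable P) (hc : 17 ≤ P.card)
    {v w w' : Plane} (hv : IsHullVertex P v) (h : CutsOff P v w S) (hS : S.card ≤ 4)
    (e : IsHullEdge P w w') : CutsOff P v w' (insert w S) := by
  obtain ⟨b, eb⟩ := id hv
  obtain ⟨hw, hwv, hSP, hq⟩ := id h
  have hw'v : w' ≠ v := by
    rintro rfl
    exact h.ne_of_hullEdge e (by omega) rfl
  have hww' : 0 < ori v w w' := by
    rw [← ori_rotate]
    exact e.2.2.2 v eb.1 hwv.symm hw'v.symm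
  have hinsP : insert w S ⊆ P := Finset.insert_subset hw hSP
  refine ⟨e.2.1, hw'v, hinsP, fun q hqP => ⟨fun hqr => ?_, fun hqS => ?_⟩⟩
  · by_contra hqS
    set B : Finset Plane := P.filter (fun q => ori v w' q < 0 ∧ q ∉ insert w S) with hB
    have hBside : ∀ z ∈ B, 0 < ori v b z := by
      intro z hz
      simp only [hB, Finset.mem_filter, Finset.mem_insert, not_or] at hz
      refine eb.2.2.2 z hz.1 ?_ ?_
      · rintro rfl; rw [ori_self_left] at hz; exact lt_irrefl _ hz.2.1
      · rintro rfl
        refine hz.2.2.2 ((hq z hz.1).mp ?_)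
        rw [ori_swap]
        linarith [eb.2.2.2 w hw hwv (Ne.symm hz.2.2.1)]
    obtain ⟨c, hcB, hcfirst⟩ := exists_angular_first hP eb.1 (d0 := b 0 - v 0) (d1 := b 1 - v 1)
      (S := B) (Finset.filter_subset _ _)
      (fun hvB => by have := hBside v hvB; rw [ori_self_left] at this; exact lt_irrefl _ this)
      ⟨q, by simp only [hB, Finset.mem_filter]; exact ⟨hqP, hqr, hqS⟩⟩ hBside
    have hcB' := hcB
    simp only [hB, Finset.mem_filter] at hcB'
    obtain ⟨hcP, hcr, hcS⟩ := hcB'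
    have hcv : c ≠ v := by rintro rfl; rw [ori_self_left] at hcr; exact lt_irrefl _ hcr
    have hcw : c ≠ w := fun h => hcS (by simp [h])
    have hcw' : c ≠ w' := by rintro rfl; rw [ori_self_right] at hcr; exact lt_irrefl _ hcr
    have hcw'pos : 0 < ori v c w' := by rw [ori_swap]; linarith
    have hsub : rightOf P v c ⊆ insert w S := by
      intro z hz
      rw [mem_rightOf] at hz
      by_contra hzS
      have h1 : 0 < ori v z w' :=
        eb.angular_trans hz.1 hcP e.2.1 (by rw [ori_swap]; linarith [hz.2]) hcw'pos
      have h2 : z ∈ B := by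
        simp only [hB, Finset.mem_filter]
        exact ⟨hz.1, by rw [ori_swap]; linarith, hzS⟩
      have h3 := hcfirst z h2 (by rintro rfl; linarith [ori_self_right v z, hz.2])
      linarith [hz.2]
    have hcard := (Finset.card_le_card hsub).trans (Finset.card_insert_le w S)
    have hch : IsHullVertex P c := hv.of_card_rightOf_le hP hno hc hcP hcv (by omega)
    refine hch.not_in_triangle eb.1 hw e.2.1 ?_ (e.2.2.2 c hcP hcw hcw')
      (by rw [ori_swap']; linarith)
    refine lt_of_le_of_ne (not_lt.mp fun hlt => hcS ?_)
      (Ne.symm (hP.ori_ne_zero eb.1 hw hcP hwv.symm hcw.symm hcv.symm))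
    exact Finset.mem_insert_of_mem ((hq c hcP).mp hlt)
  · rw [ori_swap]
    rcases Finset.mem_insert.mp hqS with rfl | hqS
    · linarith
    · have h1 := (hq q hqP).mpr hqS
      have := eb.angular_trans hqP hw e.2.1 (by rw [ori_swap]; linarith) hww'
      linarith

theorem eightRemovable {P : Finset Plane} (hP : InGeneralPosition (P : Set Plane))
    (hc : 17 ≤ P.card) : EightRemovable P := by
  classical
  by_contra hno
  have h3 : 3 ≤ P.card := by omega
  obtain ⟨v₁, v₂, e₁⟩ := exists_hullEdge hP (by omega)
  obtain ⟨v₃, e₂⟩ := e₁.exists_next hP h3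
  obtain ⟨v₄, e₃⟩ := e₂.exists_next hP h3
  obtain ⟨v₅, e₄⟩ := e₃.exists_next hP h3
  obtain ⟨v₆, e₅⟩ := e₄.exists_next hP h3
  obtain ⟨v₇, e₆⟩ := e₅.exists_next hP h3
  obtain ⟨v₈, e₇⟩ := e₆.exists_next hP h3
  have hv : IsHullVertex P v₂ := ⟨v₃, e₂⟩
  have c₃ : CutsOff P v₂ v₃ ∅ := ⟨e₂.2.1, e₂.2.2.1.symm, by simp, fun q hq => by
    simpa using e₂.ori_nonneg hq⟩
  have c₄ : CutsOff P v₂ v₄ {v₃} := by simpa using c₃.next hP hno hc hv (by simp) e₃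
  have c₅ := c₄.next hP hno hc hv (by simp) e₄
  have c₆ := c₅.next hP hno hc hv (Finset.card_le_two.trans (by omega)) e₅
  have c₇ := c₆.next hP hno hc hv (Finset.card_le_three.trans (by omega)) e₆
  -- The cap is already given by `c₇`; `c₈` only shows that v₈ differs from the earlier vertices.
  have c₈ := c₇.next hP hno hc hv Finset.card_le_four e₇
  have d₁₃ := c₃.ne_of_hullEdge e₁ (by simpa using h3)
  have d₁₄ := c₄.ne_of_hullEdge e₁ (by rw [Finset.card_singleton]; omega)
  have d₁₅ := c₅.ne_of_hullEdge e₁ (by linarith [Finset.card_le_two (a := v₄) (b := v₃)])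
  have d₁₆ := c₆.ne_of_hullEdge e₁
    (by linarith [Finset.card_le_three (a := v₅) (b := v₄) (c := v₃)])
  have d₁₇ := c₇.ne_of_hullEdge e₁
    (by linarith [Finset.card_le_four (a := v₆) (b := v₅) (c := v₄) (d := v₃)])
  have d₁₈ := c₈.ne_of_hullEdge e₁
    (by linarith [Finset.card_le_five (a := v₇) (b := v₆) (c := v₅) (d := v₄) (e := v₃)])
  have n₄ := c₄.right_notMem
  have n₅ := c₅.right_notMem
  have n₆ := c₆.right_notMem
  have n₇ := c₇.right_notMem
  have n₈ := c₈.right_notMem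
  simp only [Finset.mem_insert, Finset.mem_singleton, not_or] at n₄ n₅ n₆ n₇ n₈
  refine hno (exists_remove_eight_of_cap e₁ e₃ e₅ e₇ ?_ ?_ ?_ ?_ ?_ ?_)
  · simp only [List.nodup_cons, List.mem_cons, List.not_mem_nil, or_false, not_or, not_false_eq_true,
      List.nodup_nil, and_true]
    exact ⟨⟨e₁.2.2.1, d₁₃, d₁₄, d₁₅, d₁₆, d₁₇, d₁₈⟩,
      ⟨c₃.2.1.symm, c₄.2.1.symm, c₅.2.1.symm, c₆.2.1.symm, c₇.2.1.symm, c₈.2.1.symm⟩,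
      ⟨Ne.symm n₄, Ne.symm n₅.2, Ne.symm n₆.2.2, Ne.symm n₇.2.2.2, Ne.symm n₈.2.2.2.2⟩,
      ⟨Ne.symm n₅.1, Ne.symm n₆.2.1, Ne.symm n₇.2.2.1, Ne.symm n₈.2.2.2.1⟩,
      ⟨Ne.symm n₆.1, Ne.symm n₇.2.1, Ne.symm n₈.2.2.1⟩,
      ⟨Ne.symm n₇.1, Ne.symm n₈.2.1⟩, Ne.symm n₈.1⟩
  · intro q hq hqr
    have := (c₇.2.2.2 q hq).mp hqr
    simp only [Finset.mem_insert, Finset.mem_singleton] at this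
    tauto
  · rw [ori_rotate]
    exact e₁.2.2.2 v₇ c₇.1 (Ne.symm d₁₇) c₇.2.1
  · exact (c₇.2.2.2 v₄ c₄.1).mpr (by simp)
  · exact (c₇.2.2.2 v₆ c₆.1).mpr (by simp)
  · rw [← ori_rotate]
    exact e₇.2.2.2 v₂ e₂.1 c₇.2.1.symm c₈.2.1.symm

/-! ### The main bound -/

theorem exists_cover (n : ℕ) : ∀ P : Finset Plane, P.card = n →
    InGeneralPosition (P : Set Plane) →
    ∃ k, 11 * k ≤ 7 * n + 44 ∧ CoveredByConvex k (P : Set Plane)ᶜ := by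
  induction n using Nat.strong_induction_on with
  | _ n ih =>
    intro P hPn hP
    by_cases hn : 17 ≤ n
    -- The step closes because 11 · 5 = 55 ≤ 56 = 7 · 8.
    · obtain ⟨Q, hQ, hc, hk⟩ := eightRemovable hP (by omega)
      obtain ⟨k, hk1, hk2⟩ := ih (n - 8) (by omega) Q (by omega) (hP.subset (by exact_mod_cast hQ))
      exact ⟨k + 5, by omega, hk k hk2⟩
    · obtain ⟨k, hk1, hk2⟩ := exists_cover_two_thirds n P hPn hP
      exact ⟨k, by omega, hk2⟩

theorem theorem5 (n : ℕ) :
    (∀ P : Finset Plane, P.card = n → InGeneralPosition (P : Set Plane) →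
      ∃ k : ℕ, (k : ℝ) ≤ 7 * (n : ℝ) / 11 + 4 ∧ CoveredByConvex k (P : Set Plane)ᶜ) ∧
    (covMax n : ℝ≥0∞) ≤ 7 * (n : ℝ≥0∞) / 11 + 4 := by
  refine ⟨fun P hPn hP => ?_, ?_⟩
  · obtain ⟨k, hk, hcov⟩ := exists_cover n P hPn hP
    refine ⟨k, ?_, hcov⟩
    have : (11 : ℝ) * k ≤ 7 * n + 44 := by exact_mod_cast hk
    linarith
  -- The number of sets is an integer, so the bound can be stated with a floor in `ℕ∞` before
  -- passing to `ℝ≥0∞`.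
  · have h1 : covMax n ≤ (((7 * n + 44) / 11 : ℕ) : ℕ∞) := by
      refine iSup_le fun P => iSup_le fun hPn => iSup_le fun hP => ?_
      obtain ⟨k, hk, hcov⟩ := exists_cover n P hPn hP
      refine (iInf₂_le k hcov).trans ?_
      exact_mod_cast (Nat.le_div_iff_mul_le (by norm_num)).mpr (by omega)
    have h2 : (covMax n : ℝ≥0∞) ≤ ((((7 * n + 44) / 11 : ℕ) : ℕ∞) : ℝ≥0∞) :=
      ENat.toENNReal_le.mpr h1
    refine h2.trans ?_
    rw [ENat.toENNReal_coe]
    have h3 : 11 * ((7 * n + 44) / 11) ≤ 7 * n + 44 := Nat.mul_div_le _ _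
    have h4 : (7 * (n : ℝ≥0∞) / 11 + 4) = (7 * n + 44) / 11 := by
      rw [ENNReal.add_div]
      congr 1
      rw [ENNReal.eq_div_iff (by norm_num) (by norm_num)]
      norm_num
    rw [h4, ENNReal.le_div_iff_mul_le (by simp) (by simp), mul_comm]
    exact_mod_cast h3
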